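/- A knot projection $P$ is a generic immersed closed curve on the sphere $S^2$: a smooth immersion of the circle into $S^2$ whose only self-intersections are finitely many transverse double points. Its chord diagram $CD_P$ is the circle in which, for every double point, the two preimages are joined by a chord; two chords cross if their endpoints are interlaced on the circle. Let $\otimes(P)$ be the number of pairs of crossing chords in $CD_P$ (cross chords), $\mathrm{tr}(P)$ the number of triples of mutually crossing chords (triple chords), and $H(P)$ the number of triples of chords consisting of two distinct non-crossing chords and a third chord that crosses both (H-chords). The first Reidemeister move RI replaces, inside a disc on the sphere, a simple arc of the curve by an arc with exactly one kink (or conversely). The strong third Reidemeister move replaces, inside a disc that the curve meets in three simple branches, each two of which cross exactly once so that the branches bound a triangle, these branches by three branches with the same endpoints that bound the opposite triangle (one branch is pushed across the crossing of the other two), where the curve outside the disc joins the six endpoints of the branches on the boundary circle of the disc in three pairs of neighbouring endpoints. Both moves leave the curve unchanged outside the disc. **Theorem.** For every knot projection $P$ the number $$\lambda(P)=\frac{3\,H(P)-3\,\mathrm{tr}(P)+\otimes(P)}{4}$$ is an integer. It depends only on $P$ up to homeomorphisms of the sphere and reparametrization (including reversal) of the circle, and it is invariant under RI and strong RIII: if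 $Q$ is obtained from $P$ by a move RI or a strong RIII, then $\lambda(Q)=\lambda(P)$. -/

import Mathlib

open Set
open scoped ContDiff

/-- The unit sphere `S²` in Euclidean three-space. -/
abbrev S2 : Type := Metric.sphere (0 : EuclideanSpace ℝ (Fin 3)) 1

/-- A (parametrized) knot projection, i.e. a generic immersed closed curve on the sphere: a smooth
immersion of the circle `ℝ / ℤ` (written as a `1`-periodic map on `ℝ`) into `S²` whose
self-intersections are finitely many transverse double points. -/
structure KnotProjection where
  /-- the curve -/
  toFun : ℝ → S2
  periodic : ∀ t, toFun (t + 1) = toFun t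
  smooth : ContDiff ℝ ∞ (fun t => (toFun t : EuclideanSpace ℝ (Fin 3)))
  immersion : ∀ t, deriv (fun t => (toFun t : EuclideanSpace ℝ (Fin 3))) t ≠ 0
  /-- there are no triple points -/
  no_triple : ∀ r ∈ Ico (0 : ℝ) 1, ∀ s ∈ Ico (0 : ℝ) 1, ∀ t ∈ Ico (0 : ℝ) 1,
    toFun r = toFun s → toFun s = toFun t → r = s ∨ s = t ∨ r = t
  /-- the two branches through a double point are transverse -/
  transverse : ∀ s ∈ Ico (0 : ℝ) 1, ∀ t ∈ Ico (0 : ℝ) 1, s ≠ t → toFun s = toFun t →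
    LinearIndependent ℝ
      ![deriv (fun t => (toFun t : EuclideanSpace ℝ (Fin 3))) s,
        deriv (fun t => (toFun t : EuclideanSpace ℝ (Fin 3))) t]
  /-- there are finitely many double points -/
  finite_double : {c : ℝ × ℝ | 0 ≤ c.1 ∧ c.1 < c.2 ∧ c.2 < 1 ∧ toFun c.1 = toFun c.2}.Finite

namespace KnotProjection

/-- The chords of the chord diagram `CD_P`: a chord joins the two preimages `s < t` in the circle
`ℝ / ℤ = [0, 1)` of a double point of `P`. -/
def chords (P : KnotProjection) : Set (ℝ × ℝ) :=
  {c | 0 ≤ c.1 ∧ c.1 < c.2 ∧ c.2 < 1 ∧ P.toFun c.1 = P.toFun c.2}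

/-- Two chords of the circle `[0, 1)` cross: their endpoints are interlaced. -/
def Crosses (c d : ℝ × ℝ) : Prop :=
  (c.1 < d.1 ∧ d.1 < c.2 ∧ c.2 < d.2) ∨ (d.1 < c.1 ∧ c.1 < d.2 ∧ d.2 < c.2)

/-- `⊗(P)`: the number of cross chords, i.e. pairs of crossing chords, in `CD_P`. -/
noncomputable def crossCount (P : KnotProjection) : ℕ :=
  {S : Set (ℝ × ℝ) | S ⊆ P.chords ∧ ∃ c d, S = {c, d} ∧ Crosses c d}.ncard

/-- `tr(P)`: the number of triple chords, i.e. triples of mutually crossing chords, in `CD_P`. -/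
noncomputable def tripleCount (P : KnotProjection) : ℕ :=
  {S : Set (ℝ × ℝ) | S ⊆ P.chords ∧
    ∃ c d e, S = {c, d, e} ∧ Crosses c d ∧ Crosses c e ∧ Crosses d e}.ncard

/-- `H(P)`: the number of H-chords, i.e. triples of chords consisting of two parallel (distinct,
non-crossing) chords `d`, `e` and a chord `c` crossing both of them, in `CD_P`. -/
noncomputable def hCount (P : KnotProjection) : ℕ :=
  {S : Set (ℝ × ℝ) | S ⊆ P.chords ∧
    ∃ c d e, S = {c, d, e} ∧ d ≠ e ∧ Crosses c d ∧ Crosses c e ∧ ¬ Crosses d e}.ncard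

/-- `λ(P) = [3 H(P) - 3 tr(P) + ⊗(P)] / 4`, as a rational number. -/
noncomputable def lambdaInv (P : KnotProjection) : ℚ :=
  (3 * (P.hCount : ℚ) - 3 * (P.tripleCount : ℚ) + (P.crossCount : ℚ)) / 4

/-- `P` and `Q` are the same knot projection up to a homeomorphism of the sphere (in particular, up
to ambient isotopy) and up to a reparametrization of the circle, which may reverse the
orientation. -/
def Equivalent (P Q : KnotProjection) : Prop :=
  ∃ (h : S2 ≃ₜ S2) (ρ : ℝ ≃ₜ ℝ),
    ((∀ t, ρ (t + 1) = ρ t + 1) ∨ (∀ t, ρ (t + 1) = ρ t - 1)) ∧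
    ∀ t, Q.toFun (ρ t) = h (P.toFun t)

/-- `φ` and `ψ` restrict to two topological embeddings of the closed unit disc of the plane into
the sphere, with the same image and with the same boundary values. -/
def DiscPair (φ ψ : ℂ → S2) : Prop :=
  ContinuousOn φ (Metric.closedBall 0 1) ∧ InjOn φ (Metric.closedBall 0 1) ∧
  ContinuousOn ψ (Metric.closedBall 0 1) ∧ InjOn ψ (Metric.closedBall 0 1) ∧
  φ '' Metric.closedBall 0 1 = ψ '' Metric.closedBall 0 1 ∧
  EqOn φ ψ (Metric.sphere 0 1)

/-- On the parameter interval `[a, b]`, the curve `P` runs once along the `φ`-image of the model arc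
`α : [-1, 1] → ℂ`, up to a monotone change of parameter. -/
def RunsAlong (P : KnotProjection) (a b : ℝ) (φ : ℂ → S2) (α : ℝ → ℂ) : Prop :=
  ∃ θ : ℝ → ℝ, ContinuousOn θ (Icc a b) ∧ StrictMonoOn θ (Icc a b) ∧ θ a = -1 ∧ θ b = 1 ∧
    ∀ t ∈ Icc a b, P.toFun t = φ (α (θ t))

/-- The model arc without double points from `-1` to `1` (the diameter of the unit disc). -/
def plainArc (s : ℝ) : ℂ := ⟨s, 0⟩

/-- The model arc with one kink from `-1` to `1` in the unit disc; its only double point is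
`kinkArc (-1/2) = kinkArc (1/2)`, and it meets the unit circle only in its endpoints. -/
noncomputable def kinkArc (s : ℝ) : ℂ := ⟨s * (4 * s ^ 2 - 1) / 3, (1 - s ^ 2) / 2⟩

/-- The first Reidemeister move RI: inside a disc on the sphere, a simple arc of `P` is replaced by
an arc with one kink; outside the disc nothing changes. (`Q` is the projection with the additional
double point; composing the embedding of the disc with reflections gives all positions of the
kink.) -/
def RI (P Q : KnotProjection) : Prop :=
  ∃ (φ ψ : ℂ → S2) (a b : ℝ), DiscPair φ ψ ∧ a < b ∧ b < a + 1 ∧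
    RunsAlong P a b φ plainArc ∧ RunsAlong Q a b ψ kinkArc ∧
    ∀ t ∈ Ioo b (a + 1), P.toFun t = Q.toFun t ∧ P.toFun t ∉ φ '' Metric.closedBall 0 1

/-- First fixed branch of the model of RIII: the diameter of the unit disc from the point NW
`(-3/5, 4/5)` to the point SE `(3/5, -4/5)`. -/
noncomputable def branchNWSE (s : ℝ) : ℂ := ⟨3 * s / 5, -(4 * s / 5)⟩

/-- Second fixed branch of the model of RIII: the diameter of the unit disc from the point SW
`(-3/5, -4/5)` to the point NE `(3/5, 4/5)`. -/
noncomputable def branchSWNE (s : ℝ) : ℂ := ⟨3 * s / 5, 4 * s / 5⟩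

/-- Third branch before the model RIII move, from E `(1, 0)` to W `(-1, 0)`, passing above the
crossing `0` of the two other branches. -/
noncomputable def branchUpper (s : ℝ) : ℂ := ⟨-s, (1 - s ^ 2) / 2⟩

/-- Third branch after the model RIII move, from E `(1, 0)` to W `(-1, 0)`, passing below the
crossing `0` of the two other branches. -/
noncomputable def branchLower (s : ℝ) : ℂ := ⟨-s, -((1 - s ^ 2) / 2)⟩

/-- The strong third Reidemeister move: a disc on the sphere meets `P` in three pairwise crossing
branches, the third of which is pushed across the crossing of the two others, so that the triangle
formed by the branches is replaced by the opposite one; outside the disc nothing changes. The move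
is strong: outside the disc, the curve joins the six boundary points
E, NE, NW, W, SW, SE (in this order on the boundary of the disc) in the adjacent pairs
W-NW, SE-SW and NE-E. (The other pairing NW-NE, W-SW, SE-E of adjacent points, and reversed
orientations, are obtained by composing the embedding of the disc with reflections and exchanging
`P` and `Q`.) -/
def StrongRIII (P Q : KnotProjection) : Prop :=
  ∃ (φ ψ : ℂ → S2) (a b c d e f : ℝ), DiscPair φ ψ ∧
    a < b ∧ b < c ∧ c < d ∧ d < e ∧ e < f ∧ f < a + 1 ∧
    RunsAlong P a b φ branchUpper ∧ RunsAlong P c d φ branchNWSE ∧ RunsAlong P e f φ branchSWNE ∧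
    RunsAlong Q a b ψ branchLower ∧ RunsAlong Q c d ψ branchNWSE ∧ RunsAlong Q e f ψ branchSWNE ∧
    ∀ t ∈ Ioo b c ∪ Ioo d e ∪ Ioo f (a + 1),
      P.toFun t = Q.toFun t ∧ P.toFun t ∉ φ '' Metric.closedBall 0 1

end KnotProjection

/-!
The numbers `⊗`, `tr` and `H` count the edges, the triangles and the induced paths with three
vertices of the crossing graph of the chord diagram. With the degrees `d` of this graph, counting
pairs of neighbours gives `∑ d (d - 1) / 2 = H + 3 tr`, hence
`8 λ = ∑ (3 d² - 2 d) - 24 tr` (`KnotProjection.lambdaInv_eq`).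

*Integrality.* All degrees are even (`KnotProjection.even_crossing_chords`), and for `d = 2 k` the
summand `3 d² - 2 d = 4 k (3 k - 1)` is divisible by `8`. Evenness is a topological fact: the curve
misses a point of the sphere, so stereographic projection makes it a plane curve `γ`. A double point
`γ s = γ t` splits `γ` into two loops, and the chords that cross the chord `(s, t)` are the crossings
of these two loops. Let a point `γ v` run along the second loop. The winding number of the first loop
about it is locally constant away from the crossings (`exp_logChange_eq_one`,
`continuousAt_logChange`) and changes by one at each crossing (`logChange_jump`). Its limits at the
two ends of the second loop agree (`logChange_ends`), because at the transverse double point the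
second loop leaves and returns in the same sector of the first one. So the number of crossings is
even (`even_ncard_crossings`). Only the parity of the winding number is needed; it is the sign
`exp (J / 2)`, where `J` is the integral of `dz / (z - γ v)` over the first loop.

*Invariance.* The crossing graph does not depend on the base point and the orientation of the circle,
nor on the homeomorphism of the sphere (`KnotProjection.Equivalent.lambdaInv_eq`). A move RI adds an
isolated vertex to the graph (`KnotProjection.RI.lambdaInv_eq`). A strong RIII replaces three mutually
non-adjacent vertices by three mutually adjacent ones; every other vertex is adjacent to none or to
exactly two of them, both before and after the move. The three degrees `d₁, d₂, d₃` grow by `2`, which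
adds `12 (d₁ + d₂ + d₃) + 24` to `8 λ`; and there are `1 + (d₁ + d₂ + d₃) / 2` new triangles, which
subtract the same amount (`eightLambda_triangle_move`).
-/

open Filter Topology

/-! ### The change of the logarithm along an arc -/

/-- The total change of a logarithm of `γ - z` along the parameter interval from `x` to `y`. -/
noncomputable def logChange (γ : ℝ → ℂ) (x y : ℝ) (z : ℂ) : ℂ :=
  ∫ u in x..y, deriv γ u / (γ u - z)

lemma continuousOn_logDeriv {γ : ℝ → ℂ} (hγ : ContDiff ℝ 1 γ) {x y : ℝ} {z : ℂ}
    (h : ∀ u ∈ Icc x y, γ u ≠ z) :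
    ContinuousOn (fun u => deriv γ u / (γ u - z)) (Icc x y) := by
  have h1 : Continuous (deriv γ) := hγ.continuous_deriv le_rfl
  have h2 : Continuous γ := hγ.continuous
  exact h1.continuousOn.div (by fun_prop) fun u hu => sub_ne_zero.2 (h u hu)

lemma logChange_add {γ : ℝ → ℂ} (hγ : ContDiff ℝ 1 γ) {x y w : ℝ} {z : ℂ} (hxy : x ≤ y)
    (hyw : y ≤ w) (h : ∀ u ∈ Icc x w, γ u ≠ z) :
    logChange γ x y z + logChange γ y w z = logChange γ x w z := by
  have hc := continuousOn_logDeriv hγ h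
  refine intervalIntegral.integral_add_adjacent_intervals ?_ ?_
  · exact (hc.mono (Icc_subset_Icc_right hyw)).intervalIntegrable_of_Icc hxy
  · exact (hc.mono (Icc_subset_Icc_left hxy)).intervalIntegrable_of_Icc hyw

/-- Along an arc that avoids a ray from `z`, the change of the logarithm is computed by the branch
of the logarithm that is cut along this ray. -/
lemma logChange_eq_log {γ : ℝ → ℂ} (hγ : ContDiff ℝ 1 γ) {x y : ℝ} {z w : ℂ} (hxy : x ≤ y)
    (h : ∀ u ∈ Icc x y, w * (γ u - z) ∈ Complex.slitPlane) :
    logChange γ x y z = Complex.log (w * (γ y - z)) - Complex.log (w * (γ x - z)) := by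
  have hne : ∀ u ∈ Icc x y, w * (γ u - z) ≠ 0 := fun u hu => Complex.slitPlane_ne_zero (h u hu)
  refine intervalIntegral.integral_eq_sub_of_hasDerivAt
    (f := fun u => Complex.log (w * (γ u - z))) (fun u hu => ?_) ?_
  · rw [uIcc_of_le hxy] at hu
    have h1 : HasDerivAt γ (deriv γ u) u := (hγ.differentiable one_ne_zero u).hasDerivAt
    have h2 := ((h1.sub_const z).const_mul w).clog_real (h u hu)
    exact h2.congr_deriv (mul_div_mul_left _ _ (left_ne_zero_of_mul (hne u hu)))
  · exact (continuousOn_logDeriv hγ fun u hu e => hne u hu (by simp [e])).intervalIntegrable_of_Icc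
      hxy

lemma continuousAt_logChange {γ : ℝ → ℂ} (hγ : ContDiff ℝ 1 γ) {x y : ℝ} {z : ℂ} (hxy : x ≤ y)
    (h : ∀ u ∈ Icc x y, γ u ≠ z) : ContinuousAt (logChange γ x y) z := by
  have h1 : Continuous (deriv γ) := hγ.continuous_deriv le_rfl
  have h2 : Continuous γ := hγ.continuous
  obtain ⟨m, hm, hmin⟩ : ∃ m > 0, ∀ u ∈ Icc x y, m ≤ ‖γ u - z‖ := by
    obtain ⟨u, hu, hmin⟩ := isCompact_Icc.exists_isMinOn (nonempty_Icc.2 hxy)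
      (f := fun u => ‖γ u - z‖) (by fun_prop)
    exact ⟨‖γ u - z‖, norm_pos_iff.2 (sub_ne_zero.2 (h u hu)), fun v hv => hmin hv⟩
  obtain ⟨C, hC⟩ := isCompact_Icc.exists_bound_of_continuousOn (s := Icc x y) h1.continuousOn
  have hsub : uIoc x y ⊆ Icc x y := by rw [uIoc_of_le hxy]; exact Ioc_subset_Icc_self
  refine intervalIntegral.continuousAt_of_dominated_interval (bound := fun _ => C / (m / 2))
    ?_ ?_ (by simp) ?_
  · filter_upwards with w
    exact (h1.measurable.div (h2.measurable.sub measurable_const)).aestronglyMeasurable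
  · filter_upwards [Metric.ball_mem_nhds z (half_pos hm)] with w hw
    filter_upwards with u hu
    have hu' := hsub hu
    have hd : m / 2 ≤ ‖γ u - w‖ := by
      have e1 := hmin u hu'
      have e2 : ‖γ u - z‖ ≤ ‖γ u - w‖ + ‖w - z‖ := by
        simpa using norm_add_le (γ u - w) (w - z)
      rw [Metric.mem_ball, dist_eq_norm] at hw
      linarith
    rw [norm_div]
    exact div_le_div₀ ((norm_nonneg _).trans (hC u hu')) (hC u hu') (half_pos hm) hd
  · filter_upwards with u hu
    exact continuousAt_const.div (by fun_prop) (sub_ne_zero.2 (h u (hsub hu)))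

/-- The winding number of a closed curve about a point off the curve is an integer. -/
lemma exp_logChange_eq_one {γ : ℝ → ℂ} (hγ : ContDiff ℝ 1 γ) {x y : ℝ} {z : ℂ} (hxy : x ≤ y)
    (h : ∀ u ∈ Icc x y, γ u ≠ z) (hc : γ x = γ y) : Complex.exp (logChange γ x y z) = 1 := by
  have hcont := continuousOn_logDeriv hγ h
  set F : ℝ → ℂ := fun v => Complex.exp (-logChange γ x v z) * (γ v - z) with hF
  have hint : IntervalIntegrable (fun u => deriv γ u / (γ u - z)) MeasureTheory.volume x y :=
    hcont.intervalIntegrable_of_Icc hxy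
  have hFc : ContinuousOn F (Icc x y) := by
    have h2 : Continuous γ := hγ.continuous
    have h3 : ContinuousOn (fun v => logChange γ x v z) (Icc x y) := by
      have := intervalIntegral.continuousOn_primitive_interval' hint left_mem_uIcc
      rwa [uIcc_of_le hxy] at this
    exact (Complex.continuous_exp.comp_continuousOn h3.neg).mul (by fun_prop)
  have hFd : ∀ v ∈ Ico x y, HasDerivWithinAt F 0 (Ici v) v := by
    intro v hv
    have hv' : v ∈ Icc x y := Ico_subset_Icc_self hv
    have hne : γ v - z ≠ 0 := sub_ne_zero.2 (h v hv')
    have e1 : HasDerivAt γ (deriv γ v) v := (hγ.differentiable one_ne_zero v).hasDerivAt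
    have h1 : Continuous (deriv γ) := hγ.continuous_deriv le_rfl
    have h2 : Continuous γ := hγ.continuous
    have hca : ContinuousAt (fun u => deriv γ u / (γ u - z)) v :=
      h1.continuousAt.div (by fun_prop) hne
    have e2 : HasDerivAt (fun v => logChange γ x v z) (deriv γ v / (γ v - z)) v := by
      refine intervalIntegral.integral_hasDerivAt_right ?_ ?_ hca
      · exact (hcont.mono (Icc_subset_Icc_right hv'.2)).intervalIntegrable_of_Icc hv'.1
      · exact (h1.measurable.div (h2.measurable.sub measurable_const)).stronglyMeasurable.stronglyMeasurableAtFilter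
    have e3 := (e2.neg.cexp).mul (e1.sub_const z)
    refine (e3.congr_deriv ?_).hasDerivWithinAt
    field_simp
    simp
  have hxyF := constant_of_has_deriv_right_zero hFc hFd y (right_mem_Icc.2 hxy)
  simp only [hF, hc] at hxyF
  have hne : γ y - z ≠ 0 := sub_ne_zero.2 (h y (right_mem_Icc.2 hxy))
  have h0 : logChange γ x x z = 0 := by simp [logChange]
  rw [h0, neg_zero, Complex.exp_zero, Complex.exp_neg] at hxyF
  have := mul_right_cancel₀ hne hxyF
  exact inv_eq_one.1 this

/-! ### Sign changes and linear functionals -/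

/-- The limits at the two ends of an interval of a sign function that is continuous except for
sign changes at the points of `Z` differ by the factor `(-1) ^ #Z`. -/
lemma sign_limits {t r : ℝ} (htr : t < r) (Z : Finset ℝ) :
    ∀ (ε : ℝ → ℂ) (l m : ℂ), ↑Z ⊆ Ioo t r →
    (∀ v ∈ Ioo t r, v ∉ Z → ε v ^ 2 = 1) → (∀ v ∈ Ioo t r, v ∉ Z → ContinuousAt ε v) →
    (∀ z ∈ Z, ∃ k, Tendsto ε (𝓝[>] z) (𝓝 k) ∧ Tendsto ε (𝓝[<] z) (𝓝 (-k))) →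
    Tendsto ε (𝓝[>] t) (𝓝 l) → Tendsto ε (𝓝[<] r) (𝓝 m) → m = (-1) ^ Z.card * l := by
  induction Z using Finset.induction_on with
  | empty =>
    intro ε l m _ hsq hcont _ hl hm
    have hc : ContinuousOn ε (Ioo t r) := fun v hv => (hcont v hv (by simp)).continuousWithinAt
    have key : ∃ c, EqOn ε (fun _ => c) (Ioo t r) := by
      rcases isPreconnected_Ioo.eq_or_eq_neg_of_sq_eq hc (continuousOn_const (c := (1 : ℂ)))
        (fun v hv => by simpa using hsq v hv (by simp)) (by simp) with h | h
      · exact ⟨1, h⟩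
      · exact ⟨-1, h⟩
    obtain ⟨c, hc⟩ := key
    have h1 : l = c := tendsto_nhds_unique hl (tendsto_const_nhds.congr' (by
      filter_upwards [Ioo_mem_nhdsGT htr] with v hv using (hc hv).symm))
    have h2 : m = c := tendsto_nhds_unique hm (tendsto_const_nhds.congr' (by
      filter_upwards [Ioo_mem_nhdsLT htr] with v hv using (hc hv).symm))
    simp [h1, h2]
  | insert z Z hz ih =>
    intro ε l m hZ hsq hcont hjump hl hm
    have hzI : z ∈ Ioo t r := hZ (by simp)
    obtain ⟨k, hk1, hk2⟩ := hjump z (by simp)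
    -- Reverse the sign to the left of `z`; the new function extends continuously to `z`.
    set η : ℝ → ℂ := fun v => if v < z then -ε v else if v = z then k else ε v with hη
    have hlt : ∀ v < z, η v = -ε v := fun v hv => by simp [hη, hv]
    have hgt : ∀ v, z < v → η v = ε v := fun v hv => by simp [hη, hv.not_gt, hv.ne']
    have hηz : η z = k := by simp [hη]
    have hr : Tendsto η (𝓝[>] z) (𝓝 k) := hk1.congr' (by
      filter_upwards [self_mem_nhdsWithin] with v hv using (hgt v hv).symm)
    have hl' : Tendsto η (𝓝[<] z) (𝓝 k) := by
      refine (by simpa using hk2.neg : Tendsto (fun v => -ε v) (𝓝[<] z) (𝓝 k)).congr' ?_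
      filter_upwards [self_mem_nhdsWithin] with v hv using (hlt v hv).symm
    have hcz : ContinuousAt η z := by
      rw [continuousAt_iff_continuous_left'_right']
      exact ⟨by rw [ContinuousWithinAt, hηz]; exact hl', by rw [ContinuousWithinAt, hηz]; exact hr⟩
    have hzsq : k ^ 2 = 1 := by
      refine tendsto_nhds_unique (hk1.pow 2) (tendsto_const_nhds.congr' ?_)
      have : ∀ᶠ v in 𝓝[>] z, v ∉ Z := by
        refine nhdsWithin_le_nhds ?_
        exact Z.finite_toSet.isClosed.isOpen_compl.mem_nhds (by simpa using hz)
      filter_upwards [this, Ioo_mem_nhdsGT hzI.2] with v hv hv'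
      exact (hsq v ⟨hzI.1.trans hv'.1, hv'.2⟩ (by simp [hv, hv'.1.ne'])).symm
    have hevlt : ∀ v < z, η =ᶠ[𝓝 v] fun v => -ε v := fun v hv => by
      filter_upwards [Iio_mem_nhds hv] with w hw using hlt w hw
    have hevgt : ∀ v, z < v → η =ᶠ[𝓝 v] ε := fun v hv => by
      filter_upwards [Ioi_mem_nhds hv] with w hw using hgt w hw
    have := ih η (-l) m (fun v hv => hZ (by simp [Finset.mem_coe.1 hv])) ?_ ?_ ?_ ?_ ?_
    · rw [this, Finset.card_insert_of_notMem hz]; ring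
    · intro v hv hvZ
      rcases lt_trichotomy v z with h | h | h
      · rw [hlt v h, neg_sq]; exact hsq v hv (by simp [hvZ, h.ne])
      · rw [h, hηz, hzsq]
      · rw [hgt v h]; exact hsq v hv (by simp [hvZ, h.ne'])
    · intro v hv hvZ
      rcases lt_trichotomy v z with h | h | h
      · exact ((hcont v hv (by simp [hvZ, h.ne])).neg).congr (hevlt v h).symm
      · rw [h]; exact hcz
      · exact (hcont v hv (by simp [hvZ, h.ne'])).congr (hevgt v h).symm
    · intro w hw
      obtain ⟨k', h1, h2⟩ := hjump w (by simp [hw])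
      rcases lt_trichotomy w z with h | h | h
      · exact ⟨-k', h1.neg.congr' ((hevlt w h).filter_mono nhdsWithin_le_nhds).symm,
          h2.neg.congr' ((hevlt w h).filter_mono nhdsWithin_le_nhds).symm⟩
      · exact absurd (h ▸ hw) hz
      · exact ⟨k', h1.congr' ((hevgt w h).filter_mono nhdsWithin_le_nhds).symm,
          h2.congr' ((hevgt w h).filter_mono nhdsWithin_le_nhds).symm⟩
    · refine hl.neg.congr' ?_
      filter_upwards [Ioo_mem_nhdsGT hzI.1] with v hv using (hlt v hv.2).symm
    · refine hm.congr' ?_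
      filter_upwards [Ioo_mem_nhdsLT hzI.2] with v hv using (hgt v hv.1).symm

/-- Two real-linearly independent complex numbers take prescribed values under some functional
`z ↦ Re (w z)`. -/
lemma exists_re_mul_eq {A B : ℂ} (h : LinearIndependent ℝ ![A, B]) (α β : ℝ) :
    ∃ w : ℂ, (w * A).re = α ∧ (w * B).re = β := by
  have hdet : A.re * B.im - A.im * B.re ≠ 0 := by
    intro h0
    rw [LinearIndependent.pair_iff] at h
    have h1 := h B.re (-A.re) (by apply Complex.ext <;> simp <;> linarith)
    have h2 := h B.im (-A.im) (by apply Complex.ext <;> simp <;> linarith)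
    have hA : A = 0 := Complex.ext (by simpa using h1.2) (by simpa using h2.2)
    have := h 1 0 (by simp [hA])
    simp at this
  have hinv := inv_mul_cancel₀ hdet
  refine ⟨⟨(A.re * B.im - A.im * B.re)⁻¹ * (α * B.im - β * A.im),
    (A.re * B.im - A.im * B.re)⁻¹ * (α * B.re - β * A.re)⟩, ?_, ?_⟩
  · rw [Complex.mul_re]; linear_combination α * hinv
  · rw [Complex.mul_re]; linear_combination β * hinv

lemma eventually_lt_of_deriv_pos {k : ℝ → ℝ} {k' x : ℝ} (h : HasDerivAt k k' x) (hk : 0 < k') :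
    (∀ᶠ u in 𝓝[>] x, k x < k u) ∧ ∀ᶠ u in 𝓝[<] x, k u < k x := by
  have h1 := (hasDerivAt_iff_tendsto_slope.1 h).eventually (lt_mem_nhds hk)
  constructor
  · filter_upwards [h1.filter_mono (nhdsWithin_mono x fun u (hu : x < u) => hu.ne'),
      self_mem_nhdsWithin] with u hu (hu' : x < u)
    rw [slope_def_field, div_pos_iff_of_pos_right (sub_pos.2 hu')] at hu
    linarith
  · filter_upwards [h1.filter_mono (nhdsWithin_mono x fun u (hu : u < x) => hu.ne),
      self_mem_nhdsWithin] with u hu (hu' : u < x)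
    rw [slope_def_field] at hu
    by_contra! hc
    exact absurd hu (not_lt.2 (div_nonpos_of_nonneg_of_nonpos (by linarith) (by linarith)))

/-- If the functional `z ↦ Re (w z)` is positive on the velocity of a curve at `x`, then the curve
passes at `x` from the lower to the upper side of a level line of this functional. -/
lemma exists_re_mul_lt {γ : ℝ → ℂ} {A w : ℂ} {x : ℝ} (h : HasDerivAt γ A x)
    (hw : 0 < (w * A).re) :
    ∃ δ > 0, (∀ u ∈ Ioc x (x + δ), (w * γ x).re < (w * γ u).re) ∧
      ∀ u ∈ Ico (x - δ) x, (w * γ u).re < (w * γ x).re := by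
  have h1 : HasDerivAt (fun u => (w * γ u).re) (w * A).re x := by
    exact Complex.reCLM.hasFDerivAt.comp_hasDerivAt x (h.const_mul w)
  obtain ⟨h2, h3⟩ := eventually_lt_of_deriv_pos h1 hw
  obtain ⟨a, ha, ha'⟩ := mem_nhdsGT_iff_exists_Ioc_subset.1 h2
  obtain ⟨b, hb, hb'⟩ := mem_nhdsLT_iff_exists_Ico_subset.1 h3
  rw [mem_Ioi] at ha
  rw [mem_Iio] at hb
  refine ⟨min (a - x) (x - b), lt_min (by linarith) (by linarith), fun u hu => ha' ⟨hu.1, ?_⟩,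
    fun u hu => hb' ⟨?_, hu.2⟩⟩
  · linarith [hu.2, min_le_left (a - x) (x - b)]
  · linarith [hu.1, min_le_right (a - x) (x - b)]

/-! ### Crossings of the two loops at a double point of a plane curve -/

lemma eventually_avoid {γ : ℝ → ℂ} (hγ : Continuous γ) {x y : ℝ} {p : ℂ}
    (h : ∀ u ∈ Icc x y, γ u ≠ p) : ∀ᶠ z in 𝓝 p, ∀ u ∈ Icc x y, γ u ≠ z := by
  have hc : IsClosed (γ '' Icc x y) := (isCompact_Icc.image hγ).isClosed
  filter_upwards [hc.isOpen_compl.mem_nhds (x := p) (by rintro ⟨u, hu, rfl⟩; exact h u hu rfl)]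
    with z hz u hu e
  exact hz ⟨u, hu, e⟩

/-- The limit of the change of the logarithm when the base point approaches a point of the arc
from a side on which the part of the arc near this point is seen within a slit plane. -/
lemma tendsto_logChange_of_slitPlane {γ : ℝ → ℂ} (hγ : ContDiff ℝ 1 γ) {s x y t : ℝ} {p w : ℂ}
    (hsx : s ≤ x) (hxy : x ≤ y) (hyt : y ≤ t) {F : Filter ℂ} (hF : F ≤ 𝓝 p)
    (hslit : ∀ᶠ z in F, ∀ u ∈ Icc x y, w * (γ u - z) ∈ Complex.slitPlane)
    (h1 : ∀ u ∈ Icc s x, γ u ≠ p) (h2 : ∀ u ∈ Icc y t, γ u ≠ p)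
    (hx : w * (γ x - p) ∈ Complex.slitPlane) (hy : w * (γ y - p) ∈ Complex.slitPlane) :
    Tendsto (logChange γ s t) F (𝓝 (logChange γ s x p +
      (Complex.log (w * (γ y - p)) - Complex.log (w * (γ x - p))) + logChange γ y t p)) := by
  have c1 := (continuousAt_logChange hγ hsx h1).tendsto.mono_left hF
  have c2 := (continuousAt_logChange hγ hyt h2).tendsto.mono_left hF
  have c3 : ContinuousAt (fun z => Complex.log (w * (γ y - z)) - Complex.log (w * (γ x - z))) p :=
    ContinuousAt.sub (ContinuousAt.clog (by fun_prop) hy) (ContinuousAt.clog (by fun_prop) hx)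
  refine ((c1.add (c3.tendsto.mono_left hF)).add c2).congr' ?_
  filter_upwards [hslit, hF (eventually_avoid hγ.continuous h1),
    hF (eventually_avoid hγ.continuous h2)] with z hz z1 z2
  have zz : ∀ u ∈ Icc x y, γ u ≠ z := fun u hu e =>
    Complex.slitPlane_ne_zero (hz u hu) (by simp [e])
  have zz' : ∀ u ∈ Icc s y, γ u ≠ z := fun u hu => by
    rcases le_total u x with h | h
    · exact z1 u ⟨hu.1, h⟩
    · exact zz u ⟨h, hu.2⟩
  have zz'' : ∀ u ∈ Icc s t, γ u ≠ z := fun u hu => by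
    rcases le_total u y with h | h
    · exact zz' u ⟨hu.1, h⟩
    · exact z2 u ⟨h, hu.2⟩
  rw [← logChange_eq_log hγ hxy hz, logChange_add hγ hsx hxy zz',
    logChange_add hγ (hsx.trans hxy) hyt zz'']

lemma exp_half_log_neg {a b : ℂ} (h : a.im * b.im < 0) :
    Complex.exp ((Complex.log (-a) - Complex.log (-b)) / 2) =
      -Complex.exp ((Complex.log a - Complex.log b) / 2) := by
  have key : ∀ c : ℂ, (0 < c.im → Complex.log (-c) = Complex.log c - Real.pi * Complex.I) ∧
      (c.im < 0 → Complex.log (-c) = Complex.log c + Real.pi * Complex.I) := fun c => by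
    constructor <;> intro hc
    · rw [Complex.log, Complex.log, norm_neg, Complex.arg_neg_eq_arg_sub_pi_of_im_pos hc]
      push_cast; ring
    · rw [Complex.log, Complex.log, norm_neg, Complex.arg_neg_eq_arg_add_pi_of_im_neg hc]
      push_cast; ring
  rcases mul_neg_iff.1 h with ⟨ha, hb⟩ | ⟨ha, hb⟩
  · rw [(key a).1 ha, (key b).2 hb, show (Complex.log a - Real.pi * Complex.I -
      (Complex.log b + Real.pi * Complex.I)) / 2 = (Complex.log a - Complex.log b) / 2 -
      Real.pi * Complex.I by ring, Complex.exp_sub, Complex.exp_pi_mul_I]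
    ring
  · rw [(key a).2 ha, (key b).1 hb, show (Complex.log a + Real.pi * Complex.I -
      (Complex.log b - Real.pi * Complex.I)) / 2 = (Complex.log a - Complex.log b) / 2 +
      Real.pi * Complex.I by ring, Complex.exp_add, Complex.exp_pi_mul_I]
    ring

lemma ne_zero_and_im_ne_zero {A B : ℂ} (h : LinearIndependent ℝ ![A, B]) :
    B ≠ 0 ∧ (B⁻¹ * A).im ≠ 0 := by
  have hB : B ≠ 0 := by simpa using h.ne_zero 1
  refine ⟨hB, fun h0 => ?_⟩
  have h1 : ((B⁻¹ * A).re : ℂ) = B⁻¹ * A := Complex.ext (by simp) (by simpa using h0.symm)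
  have h2 : A = (B⁻¹ * A).re * B := by rw [h1]; field_simp
  have := LinearIndependent.pair_iff.1 h 1 (-(B⁻¹ * A).re) (by
    simp only [one_smul, Complex.real_smul, Complex.ofReal_neg]
    linear_combination h2)
  simp at this

/-- A complex number on the positive side of a half-plane whose complement contains `B` does not
lie on the ray through `B`. -/
lemma slitPlane_of_re_pos {w B z : ℂ} (hB : B ≠ 0) (hwB : (w * B).re = -1)
    (h : 0 < (w * z).re) : -B⁻¹ * z ∈ Complex.slitPlane := by
  rw [Complex.mem_slitPlane_iff_not_le_zero]
  intro hle
  obtain ⟨h1, h2⟩ := Complex.le_def.1 hle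
  have h3 : -B⁻¹ * z = ((-B⁻¹ * z).re : ℂ) := Complex.ext (by simp) (by simpa using h2)
  have h4 : z = ((-(-B⁻¹ * z).re : ℝ) : ℂ) * B := by
    rw [Complex.ofReal_neg, ← h3]; field_simp
  have h5 : (w * z).re = -(-B⁻¹ * z).re * (w * B).re := by
    conv_lhs => rw [h4, mul_left_comm, Complex.re_ofReal_mul]
  rw [hwB] at h5
  simp only [Complex.zero_re] at h1
  linarith

/-- When the base point runs along a branch that crosses the arc transversally, the winding
number changes by one at the crossing: the square root of the exponential of the change of the
logarithm changes its sign. -/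
lemma logChange_jump {γ : ℝ → ℂ} (hγ : ContDiff ℝ 1 γ) {s t u₀ v₀ : ℝ} (hu₀ : u₀ ∈ Ioo s t)
    (he : γ u₀ = γ v₀) (hind : LinearIndependent ℝ ![deriv γ u₀, deriv γ v₀])
    (huniq : ∀ u ∈ Icc s t, γ u = γ v₀ → u = u₀) :
    ∃ k, Tendsto (fun v => Complex.exp (logChange γ s t (γ v) / 2)) (𝓝[>] v₀) (𝓝 k) ∧
      Tendsto (fun v => Complex.exp (logChange γ s t (γ v) / 2)) (𝓝[<] v₀) (𝓝 (-k)) := by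
  obtain ⟨hB, him⟩ := ne_zero_and_im_ne_zero hind
  have hdu : HasDerivAt γ (deriv γ u₀) u₀ := (hγ.differentiable one_ne_zero u₀).hasDerivAt
  have hdv : HasDerivAt γ (deriv γ v₀) v₀ := (hγ.differentiable one_ne_zero v₀).hasDerivAt
  set A := deriv γ u₀
  set B := deriv γ v₀
  obtain ⟨w₁, h1A, h1B⟩ := exists_re_mul_eq hind 1 (-1)
  obtain ⟨w₂, h2A, h2B⟩ := exists_re_mul_eq hind (-1) (-1)
  -- A functional vanishing on `B` and positive on `A`; it separates the two ends of the arc.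
  obtain ⟨σ, hσ⟩ : ∃ σ : ℝ, 0 < σ * (B⁻¹ * A).im := ⟨(B⁻¹ * A).im, mul_self_pos.2 him⟩
  have h3 : ∀ z : ℂ, (-Complex.I * σ * B⁻¹ * z).re = σ * (B⁻¹ * z).im := fun z => by
    rw [show -Complex.I * σ * B⁻¹ * z = (σ : ℂ) * (-Complex.I * (B⁻¹ * z)) by ring,
      Complex.re_ofReal_mul]
    simp
  obtain ⟨δ₁, hδ₁, r1, l1⟩ := exists_re_mul_lt (w := w₁) hdu (by rw [h1A]; norm_num)
  obtain ⟨δ₂, hδ₂, r2, l2⟩ := exists_re_mul_lt (w := -w₂) hdu (by simp [h2A])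
  obtain ⟨δ₃, hδ₃, r3, l3⟩ := exists_re_mul_lt (w := -Complex.I * σ * B⁻¹) hdu (by rw [h3]; exact hσ)
  obtain ⟨η₁, hη₁, R1, L1⟩ := exists_re_mul_lt (w := -w₁) hdv (by simp [h1B])
  obtain ⟨η₂, hη₂, R2, L2⟩ := exists_re_mul_lt (w := -w₂) hdv (by simp [h2B])
  obtain ⟨δ, hδ, e1, e2, e3, e4, e5⟩ : ∃ δ > 0, δ ≤ δ₁ ∧ δ ≤ δ₂ ∧ δ ≤ δ₃ ∧ s ≤ u₀ - δ ∧
      u₀ + δ ≤ t := by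
    refine ⟨min (min δ₁ δ₂) (min δ₃ (min (u₀ - s) (t - u₀))), ?_, ?_, ?_, ?_, ?_, ?_⟩
    · have := hu₀.1; have := hu₀.2
      simp only [gt_iff_lt, lt_min_iff]; refine ⟨⟨?_, ?_⟩, ?_, ?_, ?_⟩ <;> linarith
    all_goals
      have a1 := min_le_left (min δ₁ δ₂) (min δ₃ (min (u₀ - s) (t - u₀)))
      have a2 := min_le_right (min δ₁ δ₂) (min δ₃ (min (u₀ - s) (t - u₀)))
      have a3 := min_le_left δ₁ δ₂
      have a4 := min_le_right δ₁ δ₂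
      have a5 := min_le_left δ₃ (min (u₀ - s) (t - u₀))
      have a6 := min_le_right δ₃ (min (u₀ - s) (t - u₀))
      have a7 := min_le_left (u₀ - s) (t - u₀)
      have a8 := min_le_right (u₀ - s) (t - u₀)
      linarith
  simp only [neg_mul, Complex.neg_re, neg_lt_neg_iff] at r2 l2 R1 L1 R2 L2
  set q := B⁻¹ * (γ (u₀ + δ) - γ v₀) with hq
  set q' := B⁻¹ * (γ (u₀ - δ) - γ v₀) with hq'
  have hqq : q.im * q'.im < 0 := by
    have a1 := r3 (u₀ + δ) ⟨by linarith, by linarith⟩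
    have a2 := l3 (u₀ - δ) ⟨by linarith, by linarith⟩
    rw [h3, h3] at a1 a2
    have b1 : 0 < σ * q.im := by rw [hq, ← he, mul_sub, Complex.sub_im]; linarith
    have b2 : σ * q'.im < 0 := by rw [hq', ← he, mul_sub, Complex.sub_im]; linarith
    have := mul_neg_of_pos_of_neg b1 b2
    by_contra! hc
    nlinarith [mul_nonneg (mul_self_nonneg σ) hc]
  have hq0 : q.im ≠ 0 := fun h => by simp [h] at hqq
  have hq'0 : q'.im ≠ 0 := fun h => by simp [h] at hqq
  have av1 : ∀ u ∈ Icc s (u₀ - δ), γ u ≠ γ v₀ := fun u hu e => by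
    have := huniq u ⟨hu.1, by linarith [hu.2, hu₀.2]⟩ e
    linarith [hu.2]
  have av2 : ∀ u ∈ Icc (u₀ + δ) t, γ u ≠ γ v₀ := fun u hu e => by
    have := huniq u ⟨by linarith [hu.1, hu₀.1], hu.2⟩ e
    linarith [hu.1]
  have T1 := tendsto_logChange_of_slitPlane hγ (p := γ v₀) (w := -B⁻¹) (F := map γ (𝓝[>] v₀))
    e4 (by linarith) e5 (hγ.continuous.continuousAt.mono_left nhdsWithin_le_nhds)
    (by
      rw [eventually_map]
      filter_upwards [Ioc_mem_nhdsGT (show v₀ < v₀ + η₁ by linarith),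
        Ioc_mem_nhdsGT (show v₀ < v₀ + η₂ by linarith)] with v hv1 hv2 u hu
      have c1 := R1 v hv1
      have c2 := R2 v hv2
      rw [← he] at c1 c2
      rcases lt_trichotomy u u₀ with h | h | h
      · refine slitPlane_of_re_pos hB h2B ?_
        have := l2 u ⟨by linarith [hu.1], h⟩
        rw [mul_sub, Complex.sub_re]; linarith
      · refine slitPlane_of_re_pos hB h2B ?_
        rw [mul_sub, Complex.sub_re, h]; linarith
      · refine slitPlane_of_re_pos hB h1B ?_
        have := r1 u ⟨h, by linarith [hu.2]⟩
        rw [mul_sub, Complex.sub_re]; linarith)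
    av1 av2 (Or.inr (by rw [neg_mul, Complex.neg_im]; exact neg_ne_zero.2 hq'0))
    (Or.inr (by rw [neg_mul, Complex.neg_im]; exact neg_ne_zero.2 hq0))
  have T2 := tendsto_logChange_of_slitPlane hγ (p := γ v₀) (w := B⁻¹) (F := map γ (𝓝[<] v₀))
    e4 (by linarith) e5 (hγ.continuous.continuousAt.mono_left nhdsWithin_le_nhds)
    (by
      rw [eventually_map]
      filter_upwards [Ico_mem_nhdsLT (show v₀ - η₁ < v₀ by linarith),
        Ico_mem_nhdsLT (show v₀ - η₂ < v₀ by linarith)] with v hv1 hv2 u hu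
      have c1 := L1 v hv1
      have c2 := L2 v hv2
      rw [← he] at c1 c2
      rw [show B⁻¹ * (γ u - γ v) = -B⁻¹ * (γ v - γ u) by ring]
      rcases lt_trichotomy u u₀ with h | h | h
      · refine slitPlane_of_re_pos hB h1B ?_
        have := l1 u ⟨by linarith [hu.1], h⟩
        rw [mul_sub, Complex.sub_re]; linarith
      · refine slitPlane_of_re_pos hB h2B ?_
        rw [mul_sub, Complex.sub_re, h]; linarith
      · refine slitPlane_of_re_pos hB h2B ?_
        have := r2 u ⟨h, by linarith [hu.2]⟩
        rw [mul_sub, Complex.sub_re]; linarith)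
    av1 av2 (Or.inr hq'0) (Or.inr hq0)
  rw [tendsto_map'_iff] at T1 T2
  refine ⟨_, (T1.div_const 2).cexp, ?_⟩
  refine (T2.div_const 2).cexp.trans (le_of_eq (congrArg 𝓝 ?_))
  rw [neg_mul, neg_mul, ← hq, ← hq', add_div, add_div, add_div, add_div, Complex.exp_add,
    Complex.exp_add, Complex.exp_add, Complex.exp_add, exp_half_log_neg hqq]
  ring

/-- Near a transverse double point, a line through it separates the second loop from the loop on
`[s, t]`. Hence one branch of the logarithm serves both ends of the second loop, and the winding
numbers at these ends agree. -/
lemma logChange_ends {γ : ℝ → ℂ} (hγ : ContDiff ℝ 1 γ) {s t r : ℝ} (hst : s < t)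
    (het : γ t = γ s) (her : γ r = γ s) (hdr : deriv γ r = deriv γ s)
    (hind : LinearIndependent ℝ ![deriv γ s, deriv γ t])
    (hne : ∀ u ∈ Ioo s t, γ u ≠ γ s) :
    ∃ l, Tendsto (fun v => logChange γ s t (γ v)) (𝓝[>] t) (𝓝 l) ∧
      Tendsto (fun v => logChange γ s t (γ v)) (𝓝[<] r) (𝓝 l) := by
  have hd : ∀ x, HasDerivAt γ (deriv γ x) x := fun x => (hγ.differentiable one_ne_zero x).hasDerivAt
  obtain ⟨w, hA, hB⟩ := exists_re_mul_eq hind 1 (-1)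
  obtain ⟨δ₁, hδ₁, r1, -⟩ := exists_re_mul_lt (w := w) (hd s) (by rw [hA]; norm_num)
  obtain ⟨δ₂, hδ₂, r2, l2⟩ := exists_re_mul_lt (w := -w) (hd t) (by simp [hB])
  obtain ⟨δ₃, hδ₃, -, l3⟩ := exists_re_mul_lt (w := w) (hd r) (by rw [hdr, hA]; norm_num)
  simp only [neg_mul, Complex.neg_re, neg_lt_neg_iff] at r2 l2
  rw [het] at r2 l2
  rw [her] at l3
  obtain ⟨δ, hδ, e1, e2, e3⟩ : ∃ δ > 0, δ ≤ δ₁ ∧ δ ≤ δ₂ ∧ s + δ ≤ t - δ := by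
    refine ⟨min (min δ₁ δ₂) ((t - s) / 2), ?_, ?_, ?_, ?_⟩
    · simp only [gt_iff_lt, lt_min_iff]; refine ⟨⟨?_, ?_⟩, ?_⟩ <;> linarith
    all_goals
      have a1 := min_le_left (min δ₁ δ₂) ((t - s) / 2)
      have a2 := min_le_right (min δ₁ δ₂) ((t - s) / 2)
      have a3 := min_le_left δ₁ δ₂
      have a4 := min_le_right δ₁ δ₂
      linarith
  have hmid : ∀ u ∈ Icc (s + δ) (t - δ), γ u ≠ γ s := fun u hu =>
    hne u ⟨by linarith [hu.1], by linarith [hu.2]⟩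
  have hslit : ∀ z₁ z₂ : ℂ, (w * z₂).re < (w * z₁).re → w * (z₁ - z₂) ∈ Complex.slitPlane :=
    fun z₁ z₂ h => Or.inl (by rw [mul_sub, Complex.sub_re]; linarith)
  have hright : ∀ u ∈ Icc s (s + δ), (w * γ s).re ≤ (w * γ u).re := fun u hu => by
    rcases hu.1.eq_or_lt with h | h
    · rw [h]
    · exact (r1 u ⟨h, by linarith [hu.2]⟩).le
  have hleft : ∀ u ∈ Icc (t - δ) t, (w * γ s).re ≤ (w * γ u).re := fun u hu => by
    rcases hu.2.eq_or_lt with h | h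
    · rw [h, het]
    · exact (l2 u ⟨by linarith [hu.1], h⟩).le
  have hc : ContinuousAt (fun z => Complex.log (w * (γ (s + δ) - z)) +
      logChange γ (s + δ) (t - δ) z - Complex.log (w * (γ (t - δ) - z))) (γ s) := by
    have c1 : ContinuousAt (fun z => Complex.log (w * (γ (s + δ) - z))) (γ s) :=
      ContinuousAt.clog (by fun_prop) (hslit _ _ (r1 _ ⟨by linarith, by linarith⟩))
    have c2 : ContinuousAt (fun z => Complex.log (w * (γ (t - δ) - z))) (γ s) :=
      ContinuousAt.clog (by fun_prop) (hslit _ _ (l2 _ ⟨by linarith, by linarith⟩))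
    exact (c1.add (continuousAt_logChange hγ e3 hmid)).sub c2
  have key : ∀ F : Filter ℝ, Tendsto γ F (𝓝 (γ s)) →
      (∀ᶠ v in F, (w * γ v).re < (w * γ s).re) →
      Tendsto (fun v => logChange γ s t (γ v)) F (𝓝 (Complex.log (w * (γ (s + δ) - γ s)) +
        logChange γ (s + δ) (t - δ) (γ s) - Complex.log (w * (γ (t - δ) - γ s)))) := by
    intro F hF hlt
    refine (hc.tendsto.comp hF).congr' ?_
    filter_upwards [hlt, hF (eventually_avoid hγ.continuous hmid)] with v hv hv'
    have s1 : ∀ u ∈ Icc s (s + δ), w * (γ u - γ v) ∈ Complex.slitPlane := fun u hu =>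
      hslit _ _ (hv.trans_le (hright u hu))
    have s2 : ∀ u ∈ Icc (t - δ) t, w * (γ u - γ v) ∈ Complex.slitPlane := fun u hu =>
      hslit _ _ (hv.trans_le (hleft u hu))
    have a1 : ∀ u ∈ Icc s (t - δ), γ u ≠ γ v := fun u hu => by
      rcases le_total u (s + δ) with h | h
      · exact fun e => Complex.slitPlane_ne_zero (s1 u ⟨hu.1, h⟩) (by simp [e])
      · exact hv' u ⟨h, hu.2⟩
    have a2 : ∀ u ∈ Icc s t, γ u ≠ γ v := fun u hu => by
      rcases le_total u (t - δ) with h | h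
      · exact a1 u ⟨hu.1, h⟩
      · exact fun e => Complex.slitPlane_ne_zero (s2 u ⟨h, hu.2⟩) (by simp [e])
    rw [← logChange_add hγ (y := t - δ) (by linarith) (by linarith) a2,
      ← logChange_add hγ (by linarith) e3 a1, logChange_eq_log hγ (by linarith) s1,
      logChange_eq_log hγ (by linarith) s2, het]
    simp only [Function.comp]
    ring
  refine ⟨_, key _ ?_ ?_, key _ ?_ ?_⟩
  · rw [← het]; exact hγ.continuous.continuousAt.mono_left nhdsWithin_le_nhds
  · filter_upwards [Ioc_mem_nhdsGT (show t < t + δ₂ by linarith)] with v hv using r2 v hv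
  · rw [← her]; exact hγ.continuous.continuousAt.mono_left nhdsWithin_le_nhds
  · filter_upwards [Ico_mem_nhdsLT (show r - δ₃ < r by linarith)] with v hv using l3 v hv

/-- The two loops into which a transverse double point divides a closed plane curve cross each
other an even number of times, if all their crossings are transverse. -/
theorem even_ncard_crossings {γ : ℝ → ℂ} (hγ : ContDiff ℝ 1 γ) {s t r : ℝ} (hst : s < t)
    (htr : t < r) (het : γ t = γ s) (her : γ r = γ s) (hdr : deriv γ r = deriv γ s)
    (hind : LinearIndependent ℝ ![deriv γ s, deriv γ t])
    (hne : ∀ u ∈ Ioo s t, γ u ≠ γ s) (hne' : ∀ v ∈ Ioo t r, γ v ≠ γ s)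
    (huniq : ∀ v ∈ Ioo t r, ∀ u ∈ Ioo s t, ∀ u' ∈ Ioo s t, γ u = γ v → γ u' = γ v → u' = u)
    (htrans : ∀ u ∈ Ioo s t, ∀ v ∈ Ioo t r, γ u = γ v →
      LinearIndependent ℝ ![deriv γ u, deriv γ v])
    (hfin : {v | v ∈ Ioo t r ∧ ∃ u ∈ Ioo s t, γ u = γ v}.Finite) :
    Even {v | v ∈ Ioo t r ∧ ∃ u ∈ Ioo s t, γ u = γ v}.ncard := by
  have hinner : ∀ v ∈ Ioo t r, ∀ u ∈ Icc s t, γ u = γ v → u ∈ Ioo s t := fun v hv u hu e => by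
    refine ⟨hu.1.lt_of_ne ?_, hu.2.lt_of_ne ?_⟩
    · rintro rfl; exact hne' v hv e.symm
    · rintro rfl; exact hne' v hv (e.symm.trans het)
  have havoid : ∀ v ∈ Ioo t r, v ∉ hfin.toFinset → ∀ u ∈ Icc s t, γ u ≠ γ v :=
    fun v hv hv' u hu e => hv' (hfin.mem_toFinset.2 ⟨hv, u, hinner v hv u hu e, e⟩)
  obtain ⟨l, hl, hl'⟩ := logChange_ends hγ hst het her hdr hind hne
  have := sign_limits htr hfin.toFinset (fun v => Complex.exp (logChange γ s t (γ v) / 2))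
    (Complex.exp (l / 2)) (Complex.exp (l / 2)) ?_ ?_ ?_ ?_ (hl.div_const 2).cexp
    (hl'.div_const 2).cexp
  · rw [Set.ncard_eq_toFinset_card _ hfin]
    have h1 : (-1 : ℂ) ^ hfin.toFinset.card = 1 :=
      mul_right_cancel₀ (Complex.exp_ne_zero (l / 2)) (by rw [← this, one_mul])
    exact neg_one_pow_eq_one_iff_even (by norm_num) |>.1 h1
  · intro v hv; exact (hfin.mem_toFinset.1 hv).1
  · intro v hv hv'
    rw [← Complex.exp_nat_mul]
    convert exp_logChange_eq_one hγ hst.le (havoid v hv hv') het.symm using 2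
    push_cast; ring
  · intro v hv hv'
    have h1 : ContinuousAt (fun v => logChange γ s t (γ v)) v :=
      ContinuousAt.comp (g := logChange γ s t)
        (continuousAt_logChange hγ hst.le (havoid v hv hv')) hγ.continuous.continuousAt
    exact (h1.div_const 2).cexp
  · intro v hv
    obtain ⟨hv, u, hu, e⟩ := hfin.mem_toFinset.1 hv
    exact logChange_jump hγ hu e (htrans u hu v hv e) fun u' hu' e' =>
      huniq v hv u hu u' (hinner v hv u' hu' e') e e'

/-! ### Gauss's parity condition for knot projections -/

namespace KnotProjection

/-- By a dimension count, a smooth curve does not fill the sphere. -/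
lemma exists_notMem_range (P : KnotProjection) : ∃ q : S2, ∀ t, P.toFun t ≠ q := by
  by_contra! hsurj
  set g : ℝ → ℝ × ℝ := fun t =>
    ((P.toFun t : EuclideanSpace ℝ (Fin 3)) 0, (P.toFun t : EuclideanSpace ℝ (Fin 3)) 1) with hg
  have hgc : ContDiff ℝ 1 g := by
    have h := contDiff_euclidean.1 (P.smooth.of_le (m := 1) (by simp))
    exact (h 0).prodMk (h 1)
  have hd := hgc.dense_compl_range_of_finrank_lt_finrank (by simp)
  obtain ⟨⟨x, y⟩, hxy, hmem⟩ := hd.exists_mem_open (U := {p : ℝ × ℝ | p.1 ^ 2 + p.2 ^ 2 < 1})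
    (isOpen_lt (by fun_prop) (by fun_prop)) ⟨(0, 0), by simp⟩
  simp only [mem_ofPred_eq] at hmem
  obtain ⟨t, ht⟩ := hsurj ⟨!₂[x, y, √(1 - x ^ 2 - y ^ 2)], by
    rw [mem_sphere_zero_iff_norm, EuclideanSpace.norm_eq, Real.sqrt_eq_one, Fin.sum_univ_three]
    simp [Real.sq_sqrt (show 0 ≤ 1 - x ^ 2 - y ^ 2 by linarith)]⟩
  exact hxy ⟨t, by simp [hg, ht]⟩

/-- Stereographic projection from a point off the curve turns a knot projection into a plane curve
with the same double points, which are still transverse. -/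
lemma exists_planar_curve (P : KnotProjection) : ∃ γ : ℝ → ℂ, ContDiff ℝ 1 γ ∧
    (∀ s t, γ s = γ t ↔ P.toFun s = P.toFun t) ∧
    ∀ s t, γ s = γ t → LinearIndependent ℝ
      ![deriv (fun t => (P.toFun t : EuclideanSpace ℝ (Fin 3))) s,
        deriv (fun t => (P.toFun t : EuclideanSpace ℝ (Fin 3))) t] →
      LinearIndependent ℝ ![deriv γ s, deriv γ t] := by
  obtain ⟨q, hq⟩ := P.exists_notMem_range
  have hqn : ‖(q : EuclideanSpace ℝ (Fin 3))‖ = 1 := mem_sphere_zero_iff_norm.1 q.2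
  have hfr : Module.finrank ℝ (ℝ ∙ (q : EuclideanSpace ℝ (Fin 3)))ᗮ = Module.finrank ℝ ℂ := by
    have : Fact (Module.finrank ℝ (EuclideanSpace ℝ (Fin 3)) = 2 + 1) := ⟨by simp⟩
    rw [Submodule.finrank_orthogonal_span_singleton (n := 2), Complex.finrank_real_complex]
    exact fun h => by simp [h] at hqn
  set e := ContinuousLinearEquiv.ofFinrankEq hfr
  set γ : ℝ → ℂ := fun t => e (stereoToFun (q : EuclideanSpace ℝ (Fin 3)) (P.toFun t)) with hγ
  set G : ℂ → EuclideanSpace ℝ (Fin 3) := fun z =>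
    stereoInvFunAux (q : EuclideanSpace ℝ (Fin 3)) (e.symm z) with hG
  have hGγ : ∀ t, G (γ t) = P.toFun t := fun t => by
    have := stereo_left_inv hqn (x := P.toFun t) (fun h => hq t (Subtype.ext h))
    have := congrArg (Subtype.val) this
    rw [stereoInvFun_apply] at this
    simp only [hG, hγ, stereoInvFunAux_apply, ContinuousLinearEquiv.symm_apply_apply]
    exact this
  have hγc : ContDiff ℝ 1 γ := by
    refine e.contDiff.comp (ContDiffOn.comp_contDiff (contDiffOn_stereoToFun (n := 1))
      (P.smooth.of_le (by simp)) fun t => ?_)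
    simp only [mem_ofPred_eq, innerSL_apply_apply, ne_eq]
    rw [inner_eq_one_iff_of_norm_eq_one hqn (mem_sphere_zero_iff_norm.1 (P.toFun t).2)]
    exact fun h => hq t (Subtype.ext h.symm)
  have hGc : ContDiff ℝ 1 G := by
    refine (contDiff_stereoInvFunAux).comp ?_
    exact ((ℝ ∙ (q : EuclideanSpace ℝ (Fin 3)))ᗮ).subtypeL.contDiff.comp e.symm.contDiff
  refine ⟨γ, hγc, fun s t => ⟨fun h => Subtype.ext ?_, fun h => by simp [hγ, h]⟩,
    fun s t hst hind => ?_⟩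
  · rw [← hGγ, ← hGγ, h]
  · have hd : ∀ t, deriv (fun t => (P.toFun t : EuclideanSpace ℝ (Fin 3))) t =
        fderiv ℝ G (γ t) (deriv γ t) := fun t => by
      have h1 := ((hGc.differentiable one_ne_zero (γ t)).hasFDerivAt).comp_hasDerivAt t
        (hγc.differentiable one_ne_zero t).hasDerivAt
      rw [← h1.deriv]
      congr 1
      funext t
      exact (hGγ t).symm
    refine LinearIndependent.of_comp (fderiv ℝ G (γ s)).toLinearMap ?_
    convert hind using 1
    funext i
    fin_cases i
    · simp [hd s]
    · simp [hd t, hst]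

lemma deriv_add_one (P : KnotProjection) (t : ℝ) :
    deriv (fun t => (P.toFun t : EuclideanSpace ℝ (Fin 3))) (t + 1) =
      deriv (fun t => (P.toFun t : EuclideanSpace ℝ (Fin 3))) t := by
  rw [← deriv_comp_add_const]
  simp only [P.periodic]

/-- A parameter on the second loop at a double point `s < t` has a representative in the fundamental
domain `[0, 1)`, which lies outside `[s, t]`. -/
lemma exists_mem_Ico_of_mem_Ioo (P : KnotProjection) {s t v : ℝ} (hs : 0 ≤ s) (ht : t < 1) (hst : s < t)
    (hv : v ∈ Ioo t (s + 1)) : ∃ v' ∈ Ico (0 : ℝ) 1, (v' = v ∧ t < v' ∨ v = v' + 1 ∧ v' < s) ∧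
      P.toFun v' = P.toFun v ∧ deriv (fun t => (P.toFun t : EuclideanSpace ℝ (Fin 3))) v' =
        deriv (fun t => (P.toFun t : EuclideanSpace ℝ (Fin 3))) v := by
  rcases lt_or_ge v 1 with h | h
  · exact ⟨v, ⟨by linarith [hv.1], h⟩, Or.inl ⟨rfl, hv.1⟩, rfl, rfl⟩
  · refine ⟨v - 1, ⟨by linarith, by linarith [hv.2]⟩, Or.inr ⟨by ring, by linarith [hv.2]⟩, ?_, ?_⟩
    · rw [← P.periodic, sub_add_cancel]
    · rw [← P.deriv_add_one, sub_add_cancel]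

/-- Gauss's parity condition: every chord of the chord diagram of a knot projection crosses an even
number of chords, because the two loops at a double point cross each other an even number of
times. -/
theorem even_crossing_chords (P : KnotProjection) {c : ℝ × ℝ} (hc : c ∈ P.chords) :
    Even {d | d ∈ P.chords ∧ Crosses c d}.ncard := by
  obtain ⟨s, t⟩ := c
  obtain ⟨hs, hst, ht, he⟩ := hc
  simp only at hs hst ht he
  obtain ⟨γ, hγ, hγP, hγi⟩ := P.exists_planar_curve
  have hsI : s ∈ Ico (0 : ℝ) 1 := ⟨hs, by linarith⟩
  have htI : t ∈ Ico (0 : ℝ) 1 := ⟨by linarith, ht⟩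
  have hI : ∀ u ∈ Ioo s t, u ∈ Ico (0 : ℝ) 1 := fun u hu => ⟨by linarith [hu.1], by linarith [hu.2]⟩
  -- The crossing chords correspond to the parameters `v` of the crossings on the second loop.
  have hbij : BijOn (fun d : ℝ × ℝ => if d.1 < s then d.1 + 1 else d.2)
      {d | d ∈ P.chords ∧ Crosses (s, t) d}
      {v | v ∈ Ioo t (s + 1) ∧ ∃ u ∈ Ioo s t, γ u = γ v} := by
    refine ⟨?_, ?_, ?_⟩
    · rintro ⟨x, y⟩ ⟨⟨h1, h2, h3, h4⟩, h5⟩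
      simp only at h1 h2 h3 h4
      rcases h5 with ⟨h5, h6, h7⟩ | ⟨h5, h6, h7⟩
      · simp only at h5 h6 h7
        simp only [not_lt.2 h5.le, if_false]
        exact ⟨⟨h7, by linarith⟩, x, ⟨h5, h6⟩, (hγP _ _).2 h4⟩
      · simp only at h5 h6 h7
        simp only [h5, if_true]
        exact ⟨⟨by linarith, by linarith⟩, y, ⟨h6, h7⟩, (hγP _ _).2 (by rw [P.periodic, h4])⟩
    · rintro ⟨x, y⟩ ⟨⟨h1, h2, h3, h4⟩, h5⟩ ⟨x', y'⟩ ⟨⟨h1', h2', h3', h4'⟩, h5'⟩ heq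
      simp only at h1 h2 h3 h4 h1' h2' h3' h4'
      simp only [Crosses] at h5 h5' heq
      split_ifs at heq with a b b
      · obtain rfl : x = x' := by linarith
        rcases P.no_triple x ⟨h1, by linarith⟩ y ⟨by linarith, h3⟩ y' ⟨by linarith, h3'⟩ h4
          (h4.symm.trans h4') with h | h | h
        · linarith
        · rw [h]
        · linarith
      · linarith
      · linarith
      · subst heq
        rcases P.no_triple x ⟨h1, by linarith⟩ y ⟨by linarith, h3⟩ x' ⟨by linarith, by linarith⟩ h4
          h4'.symm with h | h | h
        · linarith
        · linarith
        · rw [h]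
    · rintro v ⟨hv, u, hu, huv⟩
      obtain ⟨v', hv', h1, h2, -⟩ := P.exists_mem_Ico_of_mem_Ioo hs ht hst hv
      rw [hγP, ← h2] at huv
      rcases h1 with ⟨rfl, h1⟩ | ⟨rfl, h1⟩
      · refine ⟨(u, v'), ⟨⟨by linarith [hu.1], by linarith [hu.2], hv'.2, huv⟩,
          Or.inl ⟨hu.1, hu.2, h1⟩⟩, ?_⟩
        simp [hu.1.le]
      · refine ⟨(v', u), ⟨⟨hv'.1, by linarith [hu.1], by linarith [hu.2], huv.symm⟩,
          Or.inr ⟨h1, hu.1, hu.2⟩⟩, ?_⟩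
        simp [h1]
  have hfin : {d | d ∈ P.chords ∧ Crosses (s, t) d}.Finite :=
    P.finite_double.subset fun d hd => hd.1
  rw [Set.ncard_congr' hbij.equiv]
  refine even_ncard_crossings hγ hst (by linarith) ((hγP _ _).2 he.symm)
    ((hγP _ _).2 (P.periodic s)) ?_ (hγi _ _ ((hγP _ _).2 he)
      (P.transverse s hsI t htI hst.ne he)) ?_ ?_ ?_ ?_ (hbij.finite_iff_finite.1 hfin)
  · rw [← deriv_comp_add_const]
    congr 1
    funext x
    exact (hγP _ _).2 (P.periodic x)
  · intro u hu h
    rcases P.no_triple u (hI u hu) s hsI t htI ((hγP _ _).1 h) he with h | h | h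
    · exact hu.1.ne' h
    · exact hst.ne h
    · exact hu.2.ne h
  · intro v hv h
    obtain ⟨v', hv', h1, h2, -⟩ := P.exists_mem_Ico_of_mem_Ioo hs ht hst hv
    rw [hγP, ← h2] at h
    rcases P.no_triple v' hv' s hsI t htI h he with h | h | h <;> rcases h1 with h1 | h1 <;> linarith
  · intro v hv u hu u' hu' h h'
    obtain ⟨v', hv', h1, h2, -⟩ := P.exists_mem_Ico_of_mem_Ioo hs ht hst hv
    rw [hγP, ← h2] at h h'
    rcases P.no_triple u' (hI u' hu') v' hv' u (hI u hu) h' h.symm with h | h | h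
    · rcases h1 with h1 | h1 <;> linarith [hu'.1, hu'.2]
    · rcases h1 with h1 | h1 <;> linarith [hu.1, hu.2]
    · exact h
  · intro u hu v hv h
    obtain ⟨v', hv', h1, h2, h3⟩ := P.exists_mem_Ico_of_mem_Ioo hs ht hst hv
    refine hγi _ _ h ?_
    rw [hγP, ← h2] at h
    rw [← h3]
    refine P.transverse u (hI u hu) v' hv' (fun h => ?_) h
    rcases h1 with h1 | h1 <;> linarith [hu.1, hu.2]

end KnotProjection

/-! ### Edges, paths and triangles of a graph -/

section Counting

variable {α β γ : Type*}

open Classical in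
/-- The indicator of a relation. -/
noncomputable def ind (r : α → α → Prop) (a b : α) : ℤ := if r a b then 1 else 0

lemma ind_congr {r : α → α → Prop} {r' : β → β → Prop} {a b : α} {c d : β}
    (h : r a b ↔ r' c d) : ind r a b = ind r' c d := by
  classical exact if_congr h rfl rfl

/-- The number of elements of `C` related to `c`. -/
noncomputable def relDegree (r : α → α → Prop) (C : Finset α) (c : α) : ℤ := ∑ d ∈ C, ind r c d

/-- The number of ordered triples of mutually related elements of `C`. -/
noncomputable def orderedTriangles (r : α → α → Prop) (C : Finset α) : ℤ :=
  ∑ c ∈ C, ∑ d ∈ C, ∑ e ∈ C, ind r c d * ind r c e * ind r d e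

/-- Eight times the invariant `λ` of a chord diagram with the set of chords `C` and the crossing
relation `r`, expressed by the degrees and the triangles of the crossing graph. -/
noncomputable def eightLambda (r : α → α → Prop) (C : Finset α) : ℤ :=
  ∑ c ∈ C, (3 * relDegree r C c ^ 2 - 2 * relDegree r C c) - 4 * orderedTriangles r C

lemma eightLambda_eq_of_bijOn {r : α → α → Prop} {r' : β → β → Prop} {C : Finset α}
    {C' : Finset β} {i : α → β} (hi : BijOn i C C')
    (hr : ∀ c ∈ C, ∀ d ∈ C, (r' (i c) (i d) ↔ r c d)) :
    eightLambda r C = eightLambda r' C' := by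
  have hsum : ∀ f : β → ℤ, ∑ c ∈ C, f (i c) = ∑ c ∈ C', f c := fun f =>
    Finset.sum_nbij i hi.mapsTo hi.injOn hi.surjOn fun _ _ => rfl
  have hind : ∀ c ∈ C, ∀ d ∈ C, ind r c d = ind r' (i c) (i d) := fun c hc d hd =>
    ind_congr (hr c hc d hd).symm
  have hdeg : ∀ c ∈ C, relDegree r C c = relDegree r' C' (i c) := fun c hc => by
    rw [relDegree, relDegree, ← hsum]
    exact Finset.sum_congr rfl fun d hd => hind c hc d hd
  have htri : orderedTriangles r C = orderedTriangles r' C' := by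
    rw [orderedTriangles, orderedTriangles, ← hsum]
    refine Finset.sum_congr rfl fun c hc => ?_
    rw [← hsum]
    refine Finset.sum_congr rfl fun d hd => ?_
    rw [← hsum]
    refine Finset.sum_congr rfl fun e he => ?_
    rw [hind c hc d hd, hind c hc e he, hind d hd e he]
  rw [eightLambda, eightLambda, htri, ← hsum]
  congr 1
  exact Finset.sum_congr rfl fun c hc => by rw [hdeg c hc]

/-- A finite set of configurations that is the image of a finite set of labelled configurations,
each configuration having `k` labellings. -/
lemma card_eq_mul_ncard {T : Finset β} {f : β → γ} {k : ℕ} {S : Set γ}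
    (hS : S = f '' T) (hk : ∀ p ∈ T, {q | q ∈ T ∧ f q = f p}.ncard = k) :
    T.card = k * S.ncard := by
  classical
  rw [Finset.card_eq_sum_card_image f T, Finset.sum_const_nat (m := k), mul_comm, hS,
    ← Finset.coe_image, Set.ncard_coe_finset]
  intro b hb
  obtain ⟨p, hp, rfl⟩ := Finset.mem_image.1 hb
  rw [← hk p hp, ← Set.ncard_coe_finset]
  congr 1
  ext q
  simp

open Classical in
lemma two_mul_ncard_pairs {r : α → α → Prop} (hs : ∀ a b, r a b → r b a) (hi : ∀ a, ¬ r a a)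
    (C : Finset α) :
    2 * ({S : Set α | S ⊆ C ∧ ∃ c d, S = {c, d} ∧ r c d}.ncard : ℤ) =
      ∑ c ∈ C, ∑ d ∈ C, ind r c d := by
  have h := card_eq_mul_ncard (k := 2) (T := (C ×ˢ C).filter fun p => r p.1 p.2)
    (f := fun p => ({p.1, p.2} : Set α))
    (S := {S : Set α | S ⊆ C ∧ ∃ c d, S = {c, d} ∧ r c d}) ?_ ?_
  · rw [← Finset.sum_product', ← Nat.cast_ofNat, ← Nat.cast_mul, ← h, Finset.natCast_card_filter]
    simp only [ind]
  · ext S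
    constructor
    · rintro ⟨hS, c, d, rfl, hr⟩
      simp only [Set.insert_subset_iff, Set.singleton_subset_iff] at hS
      exact ⟨(c, d), by simpa [hr] using hS, rfl⟩
    · rintro ⟨⟨c, d⟩, hp, rfl⟩
      simp only [Finset.coe_filter, Finset.mem_product, mem_ofPred_eq] at hp
      exact ⟨by simp [Set.insert_subset_iff, hp.1.1, hp.1.2], c, d, rfl, hp.2⟩
  · rintro ⟨c, d⟩ hp
    simp only [Finset.mem_filter, Finset.mem_product] at hp
    have hne : c ≠ d := by rintro rfl; exact hi _ hp.2
    rw [show {q : α × α | q ∈ (C ×ˢ C).filter (fun p => r p.1 p.2) ∧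
      ({q.1, q.2} : Set α) = {c, d}} = {(c, d), (d, c)} from ?_]
    · rw [Set.ncard_pair]; simp [hne]
    · ext ⟨a, b⟩
      simp only [Finset.mem_filter, Finset.mem_product, mem_ofPred_eq, Set.mem_insert_iff,
        Set.mem_singleton_iff, Prod.mk.injEq, Set.pair_eq_pair_iff]
      constructor
      · exact fun h => h.2
      · rintro (⟨rfl, rfl⟩ | ⟨rfl, rfl⟩)
        · exact ⟨hp, by simp⟩
        · exact ⟨⟨hp.1.symm, hs _ _ hp.2⟩, by simp⟩

lemma triple_eq_iff {a b e c d f : α} : ({a, b, e} : Set α) = {c, d, f} ↔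
    ((a = c ∨ a = d ∨ a = f) ∧ (b = c ∨ b = d ∨ b = f) ∧ (e = c ∨ e = d ∨ e = f)) ∧
    ((c = a ∨ c = b ∨ c = e) ∧ (d = a ∨ d = b ∨ d = e) ∧ (f = a ∨ f = b ∨ f = e)) := by
  rw [Set.Subset.antisymm_iff]
  simp only [Set.insert_subset_iff, Set.singleton_subset_iff, Set.mem_insert_iff,
    Set.mem_singleton_iff]

open Classical in
lemma six_mul_ncard_triangles {r : α → α → Prop} (hs : ∀ a b, r a b → r b a) (hi : ∀ a, ¬ r a a)
    (C : Finset α) :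
    6 * ({S : Set α | S ⊆ C ∧
      ∃ c d e, S = {c, d, e} ∧ r c d ∧ r c e ∧ r d e}.ncard : ℤ) = orderedTriangles r C := by
  have h := card_eq_mul_ncard (k := 6)
    (T := (C ×ˢ C ×ˢ C).filter fun p => r p.1 p.2.1 ∧ r p.1 p.2.2 ∧ r p.2.1 p.2.2)
    (f := fun p => ({p.1, p.2.1, p.2.2} : Set α))
    (S := {S : Set α | S ⊆ C ∧ ∃ c d e, S = {c, d, e} ∧ r c d ∧ r c e ∧ r d e}) ?_ ?_
  · simp only [orderedTriangles, ← Finset.sum_product']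
    rw [← Nat.cast_ofNat, ← Nat.cast_mul, ← h, Finset.natCast_card_filter]
    refine Finset.sum_congr rfl fun p _ => ?_
    simp only [ind]
    split_ifs <;> simp_all
  · ext S
    constructor
    · rintro ⟨hS, c, d, e, rfl, hr⟩
      simp only [Set.insert_subset_iff, Set.singleton_subset_iff] at hS
      exact ⟨(c, d, e), by simpa [hr] using hS, rfl⟩
    · rintro ⟨⟨c, d, e⟩, hp, rfl⟩
      simp only [Finset.coe_filter, Finset.mem_product, mem_ofPred_eq] at hp
      exact ⟨by simp [Set.insert_subset_iff, hp.1.1, hp.1.2], c, d, e, rfl, hp.2⟩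
  · rintro ⟨c, d, e⟩ hp
    simp only [Finset.mem_filter, Finset.mem_product] at hp
    obtain ⟨⟨hc, hd, he⟩, hcd, hce, hde⟩ := hp
    have h1 : c ≠ d := by rintro rfl; exact hi _ hcd
    have h2 : c ≠ e := by rintro rfl; exact hi _ hce
    have h3 : d ≠ e := by rintro rfl; exact hi _ hde
    rw [show {q : α × α × α | q ∈ (C ×ˢ C ×ˢ C).filter (fun p => r p.1 p.2.1 ∧ r p.1 p.2.2 ∧
        r p.2.1 p.2.2) ∧ ({q.1, q.2.1, q.2.2} : Set α) = {c, d, e}} =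
      (({(c, d, e), (c, e, d), (d, c, e), (d, e, c), (e, c, d), (e, d, c)} :
        Finset (α × α × α)) : Set (α × α × α)) from ?_]
    · rw [Set.ncard_coe_finset]
      simp [h1, h2, h3, h1.symm, h2.symm, h3.symm]
    · ext ⟨x, y, z⟩
      simp only [Finset.mem_filter, Finset.mem_product, mem_ofPred_eq, Finset.coe_insert,
        Finset.coe_singleton, Set.mem_insert_iff, Set.mem_singleton_iff, Prod.mk.injEq,
        triple_eq_iff]
      constructor
      · rintro ⟨-, h, h'⟩
        grind
      · rintro (h | h | h | h | h | h) <;> obtain ⟨rfl, rfl, rfl⟩ := h <;> simp_all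

open Classical in
lemma two_mul_ncard_paths {r : α → α → Prop} (hs : ∀ a b, r a b → r b a) (hi : ∀ a, ¬ r a a)
    (C : Finset α) :
    2 * ({S : Set α | S ⊆ C ∧
      ∃ c d e, S = {c, d, e} ∧ d ≠ e ∧ r c d ∧ r c e ∧ ¬ r d e}.ncard : ℤ) =
      ∑ c ∈ C, (relDegree r C c ^ 2 - relDegree r C c) - orderedTriangles r C := by
  have h := card_eq_mul_ncard (k := 2)
    (T := (C ×ˢ C ×ˢ C).filter fun p => p.2.1 ≠ p.2.2 ∧ r p.1 p.2.1 ∧ r p.1 p.2.2 ∧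
      ¬ r p.2.1 p.2.2)
    (f := fun p => ({p.1, p.2.1, p.2.2} : Set α))
    (S := {S : Set α | S ⊆ C ∧ ∃ c d e, S = {c, d, e} ∧ d ≠ e ∧ r c d ∧ r c e ∧ ¬ r d e}) ?_ ?_
  · rw [← Nat.cast_ofNat, ← Nat.cast_mul, ← h, Finset.natCast_card_filter]
    have hdeg : ∀ c ∈ C, relDegree r C c ^ 2 - relDegree r C c =
        ∑ d ∈ C, ∑ e ∈ C, (ind r c d * ind r c e - if d = e then ind r c d else 0) := by
      intro c _
      rw [sq, relDegree, Finset.sum_mul_sum, ← Finset.sum_sub_distrib]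
      refine Finset.sum_congr rfl fun d hd => ?_
      rw [Finset.sum_sub_distrib, Finset.sum_ite_eq, if_pos hd]
    rw [Finset.sum_congr rfl hdeg, orderedTriangles]
    simp only [← Finset.sum_product', ← Finset.sum_sub_distrib]
    refine Finset.sum_congr rfl fun p _ => ?_
    obtain ⟨c, d, e⟩ := p
    by_cases hde : d = e
    · subst hde
      by_cases hcd : r c d <;> simp [ind, hi, hcd]
    · by_cases h1 : r c d <;> by_cases h2 : r c e <;> by_cases h3 : r d e <;>
        simp [ind, hde, h1, h2, h3]
  · ext S
    constructor
    · rintro ⟨hS, c, d, e, rfl, hr⟩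
      simp only [Set.insert_subset_iff, Set.singleton_subset_iff] at hS
      exact ⟨(c, d, e), by simpa [hr] using hS, rfl⟩
    · rintro ⟨⟨c, d, e⟩, hp, rfl⟩
      simp only [Finset.coe_filter, Finset.mem_product, mem_ofPred_eq] at hp
      exact ⟨by simp [Set.insert_subset_iff, hp.1.1, hp.1.2], c, d, e, rfl, hp.2⟩
  · rintro ⟨c, d, e⟩ hp
    simp only [Finset.mem_filter, Finset.mem_product] at hp
    obtain ⟨⟨hc, hd, he⟩, h3, hcd, hce, hde⟩ := hp
    have h1 : c ≠ d := by rintro rfl; exact hi _ hcd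
    have h2 : c ≠ e := by rintro rfl; exact hi _ hce
    rw [show {q : α × α × α | q ∈ (C ×ˢ C ×ˢ C).filter (fun p => p.2.1 ≠ p.2.2 ∧ r p.1 p.2.1 ∧
        r p.1 p.2.2 ∧ ¬ r p.2.1 p.2.2) ∧ ({q.1, q.2.1, q.2.2} : Set α) = {c, d, e}} =
      {(c, d, e), (c, e, d)} from ?_]
    · rw [Set.ncard_pair]; simp [h3]
    · have hed : ¬ r e d := fun h => hde (hs _ _ h)
      ext ⟨x, y, z⟩
      simp only [Finset.mem_filter, Finset.mem_product, mem_ofPred_eq, Set.mem_insert_iff,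
        Set.mem_singleton_iff, Prod.mk.injEq, triple_eq_iff]
      constructor
      · rintro ⟨⟨-, g1, g2, g3, g4⟩, h, h'⟩
        grind
      · rintro (h | h) <;> obtain ⟨rfl, rfl, rfl⟩ := h <;> simp_all [eq_comm]

lemma ind_comm {r : α → α → Prop} (hs : ∀ a b, r a b → r b a) (a b : α) :
    ind r a b = ind r b a :=
  ind_congr ⟨hs a b, hs b a⟩

lemma relDegree_insert [DecidableEq α] {r : α → α → Prop} {C : Finset α} {z : α} (hz : z ∉ C) (c : α) :
    relDegree r (insert z C) c = ind r c z + relDegree r C c := by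
  rw [relDegree, Finset.sum_insert hz, relDegree]

lemma orderedTriangles_insert [DecidableEq α] {r : α → α → Prop} (hs : ∀ a b, r a b → r b a) (hi : ∀ a, ¬ r a a)
    {C : Finset α} {z : α} (hz : z ∉ C) : orderedTriangles r (insert z C) =
      orderedTriangles r C + 3 * ∑ c ∈ C, ∑ d ∈ C, ind r z c * ind r z d * ind r c d := by
  have hzz : ind r z z = 0 := by simp [ind, hi]
  simp only [orderedTriangles, Finset.sum_insert hz, hzz, mul_zero, zero_mul, zero_add,
    Finset.sum_const_zero, Finset.sum_add_distrib]
  have h1 : ∑ c ∈ C, ∑ d ∈ C, ind r c d * ind r c z * ind r d z =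
      ∑ c ∈ C, ∑ d ∈ C, ind r z c * ind r z d * ind r c d :=
    Finset.sum_congr rfl fun c _ => Finset.sum_congr rfl fun d _ => by
      rw [ind_comm hs c z, ind_comm hs d z]; ring
  have h2 : ∑ c ∈ C, ∑ e ∈ C, ind r c z * ind r c e * ind r z e =
      ∑ c ∈ C, ∑ d ∈ C, ind r z c * ind r z d * ind r c d :=
    Finset.sum_congr rfl fun c _ => Finset.sum_congr rfl fun d _ => by
      rw [ind_comm hs c z]; ring
  rw [h1, h2]
  ring

/-- An isolated vertex of the crossing graph does not contribute. -/
lemma eightLambda_insert_isolated [DecidableEq α] {r : α → α → Prop} (hs : ∀ a b, r a b → r b a)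
    (hi : ∀ a, ¬ r a a) {C : Finset α} {z : α} (hz : z ∉ C) (h : ∀ c ∈ C, ¬ r z c) :
    eightLambda r (insert z C) = eightLambda r C := by
  have h0 : ∀ c ∈ C, ind r z c = 0 := fun c hc => by simp [ind, h c hc]
  have hzz : ind r z z = 0 := by simp [ind, hi]
  have hz0 : relDegree r C z = 0 := Finset.sum_eq_zero h0
  rw [eightLambda, eightLambda, orderedTriangles_insert hs hi hz, Finset.sum_insert hz]
  simp only [relDegree_insert hz, hzz, hz0]
  rw [Finset.sum_congr rfl fun c hc => by rw [ind_comm hs c z, h0 c hc, zero_add],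
    Finset.sum_eq_zero (s := C) (f := fun c => ∑ d ∈ C, ind r z c * ind r z d * ind r c d)
      fun c hc => Finset.sum_eq_zero fun d _ => by rw [h0 c hc]; ring]
  ring

/-- The strong third Reidemeister move on the level of crossing graphs: three vertices become
mutually adjacent, while every other vertex is adjacent to none or to two of them. The gain in
degrees is balanced by the new triangles. -/
lemma eightLambda_triangle_move [DecidableEq α] {r : α → α → Prop} (hs : ∀ a b, r a b → r b a)
    (hi : ∀ a, ¬ r a a) {O : Finset α} {x y z x' y' z' : α}
    (hx : x ∉ O) (hy : y ∉ insert x O) (hz : z ∉ insert y (insert x O))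
    (hx' : x' ∉ O) (hy' : y' ∉ insert x' O) (hz' : z' ∉ insert y' (insert x' O))
    (hxy : ¬ r x y) (hxz : ¬ r x z) (hyz : ¬ r y z) (hxy' : r x' y') (hxz' : r x' z')
    (hyz' : r y' z') (hrx : ∀ o ∈ O, (r x' o ↔ r x o)) (hry : ∀ o ∈ O, (r y' o ↔ r y o))
    (hrz : ∀ o ∈ O, (r z' o ↔ r z o))
    (htwo : ∀ o ∈ O, ind r x o + ind r y o + ind r z o = 0 ∨
      ind r x o + ind r y o + ind r z o = 2) :
    eightLambda r (insert z (insert y (insert x O))) =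
      eightLambda r (insert z' (insert y' (insert x' O))) := by
  have e0 : ∀ a, ind r a a = 0 := fun a => by simp [ind, hi]
  have ex : ∀ o ∈ O, ind r x' o = ind r x o := fun o ho => ind_congr (hrx o ho)
  have ey : ∀ o ∈ O, ind r y' o = ind r y o := fun o ho => ind_congr (hry o ho)
  have ez : ∀ o ∈ O, ind r z' o = ind r z o := fun o ho => ind_congr (hrz o ho)
  have c1 : ind r x y = 0 := by simp [ind, hxy]
  have c2 : ind r x z = 0 := by simp [ind, hxz]
  have c3 : ind r y z = 0 := by simp [ind, hyz]
  have c4 : ind r x' y' = 1 := by simp [ind, hxy']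
  have c5 : ind r x' z' = 1 := by simp [ind, hxz']
  have c6 : ind r y' z' = 1 := by simp [ind, hyz']
  have dx : relDegree r O x' = relDegree r O x := Finset.sum_congr rfl ex
  have dy : relDegree r O y' = relDegree r O y := Finset.sum_congr rfl ey
  have dz : relDegree r O z' = relDegree r O z := Finset.sum_congr rfl ez
  -- The other vertices keep their degrees.
  have hO : ∑ o ∈ O, (3 * (ind r o z' + (ind r o y' + (ind r o x' + relDegree r O o))) ^ 2 -
      2 * (ind r o z' + (ind r o y' + (ind r o x' + relDegree r O o)))) =
      ∑ o ∈ O, (3 * (ind r o z + (ind r o y + (ind r o x + relDegree r O o))) ^ 2 -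
      2 * (ind r o z + (ind r o y + (ind r o x + relDegree r O o)))) :=
    Finset.sum_congr rfl fun o ho => by
      rw [ind_comm hs o z', ind_comm hs o y', ind_comm hs o x', ind_comm hs o z, ind_comm hs o y,
        ind_comm hs o x, ex o ho, ey o ho, ez o ho]
  -- Every vertex adjacent to two of the three lies in exactly one new triangle.
  have hnew : relDegree r O x + relDegree r O y + relDegree r O z =
      2 * (∑ o ∈ O, ind r x o * ind r y o + ∑ o ∈ O, ind r x o * ind r z o +
        ∑ o ∈ O, ind r y o * ind r z o) := by
    simp only [relDegree, ← Finset.sum_add_distrib, Finset.mul_sum]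
    refine Finset.sum_congr rfl fun o ho => ?_
    have h01 : ∀ a, ind r a o * ind r a o = ind r a o := fun a => by
      by_cases h : r a o <;> simp [ind, h]
    rcases htwo o ho with h | h
    · linear_combination (2 - (ind r x o + ind r y o + ind r z o)) * h + h01 x + h01 y + h01 z
    · linear_combination -(ind r x o + ind r y o + ind r z o) * h + h01 x + h01 y + h01 z
  rw [eightLambda, eightLambda, orderedTriangles_insert hs hi hz, orderedTriangles_insert hs hi hy,
    orderedTriangles_insert hs hi hx, orderedTriangles_insert hs hi hz',
    orderedTriangles_insert hs hi hy', orderedTriangles_insert hs hi hx']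
  simp only [Finset.sum_insert hz, Finset.sum_insert hy, Finset.sum_insert hx,
    Finset.sum_insert hz', Finset.sum_insert hy', Finset.sum_insert hx', relDegree_insert hz,
    relDegree_insert hy, relDegree_insert hx, relDegree_insert hz', relDegree_insert hy',
    relDegree_insert hx', Finset.sum_add_distrib, e0, c1, c2, c3, c4, c5, c6,
    ind_comm hs y x, ind_comm hs z x, ind_comm hs z y,
    ind_comm hs y' x', ind_comm hs z' x', ind_comm hs z' y', dx, dy, dz, hO]
  have single : ∀ {a b a' b' : α}, (∀ o ∈ O, ind r a' o = ind r a o) →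
      (∀ o ∈ O, ind r b' o = ind r b o) →
      ∑ o ∈ O, ind r b' o * ind r a' o = ∑ o ∈ O, ind r a o * ind r b o ∧
      ∑ o ∈ O, ind r b' o * ind r o a' = ∑ o ∈ O, ind r a o * ind r b o := fun {a b a' b'} ha hb =>
    ⟨Finset.sum_congr rfl fun o ho => by rw [ha o ho, hb o ho, mul_comm],
      Finset.sum_congr rfl fun o ho => by rw [ind_comm hs o a', ha o ho, hb o ho, mul_comm]⟩
  have double : ∀ {a a' : α}, (∀ o ∈ O, ind r a' o = ind r a o) →
      ∑ c ∈ O, ∑ d ∈ O, ind r a' c * ind r a' d * ind r c d =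
      ∑ c ∈ O, ∑ d ∈ O, ind r a c * ind r a d * ind r c d := fun {a a'} ha =>
    Finset.sum_congr rfl fun c hc => Finset.sum_congr rfl fun d hd => by rw [ha c hc, ha d hd]
  simp only [mul_zero, zero_mul, mul_one, one_mul, Finset.sum_const_zero,
    (single ex ey).1, (single ex ey).2, (single ex ez).1, (single ex ez).2, (single ey ez).1,
    (single ey ez).2, double ex, double ey, double ez]
  linear_combination -12 * hnew

end Counting

/-! ### The invariant in terms of degrees, and its integrality -/

namespace KnotProjection

lemma crosses_symm (c d : ℝ × ℝ) (h : Crosses c d) : Crosses d c := h.symm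

lemma not_crosses_self (c : ℝ × ℝ) : ¬ Crosses c c := by simp [Crosses]

open Classical in
/-- Eight times the invariant `λ` of a finite set of chords; `0` for an infinite set. -/
noncomputable def chordLambda (C : Set (ℝ × ℝ)) : ℤ :=
  if h : C.Finite then eightLambda Crosses h.toFinset else 0

lemma chordLambda_coe (C : Finset (ℝ × ℝ)) : chordLambda C = eightLambda Crosses C := by
  rw [chordLambda, dif_pos C.finite_toSet, Finset.finite_toSet_toFinset]

lemma chordLambda_eq_of_bijOn {C C' : Set (ℝ × ℝ)} {i : ℝ × ℝ → ℝ × ℝ} (hi : BijOn i C C')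
    (hr : ∀ c ∈ C, ∀ d ∈ C, (Crosses (i c) (i d) ↔ Crosses c d)) :
    chordLambda C = chordLambda C' := by
  by_cases hC : C.Finite
  · have hC' : C'.Finite := hi.finite_iff_finite.1 hC
    rw [chordLambda, dif_pos hC, chordLambda, dif_pos hC']
    exact eightLambda_eq_of_bijOn (i := i) (by simpa using hi) (by simpa using hr)
  · have hC' : ¬ C'.Finite := fun h => hC (hi.finite_iff_finite.2 h)
    rw [chordLambda, dif_neg hC, chordLambda, dif_neg hC']

/-- The relation of `λ` to the degrees `d` and the triangles of the crossing graph: counting pairs of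
neighbours gives `Σ d (d - 1) / 2 = H + 3 tr`, and counting edges gives `Σ d = 2 ⊗`. -/
lemma lambdaInv_eq (P : KnotProjection) : P.lambdaInv = (chordLambda P.chords : ℚ) / 8 := by
  have hfin : P.chords.Finite := P.finite_double
  rw [chordLambda, dif_pos hfin]
  set C := hfin.toFinset with hC
  have hco : (C : Set (ℝ × ℝ)) = P.chords := by simp [hC]
  have h1 := two_mul_ncard_pairs crosses_symm not_crosses_self C
  have h2 := six_mul_ncard_triangles crosses_symm not_crosses_self C
  have h3 := two_mul_ncard_paths crosses_symm not_crosses_self C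
  rw [hco] at h1 h2 h3
  have h4 : eightLambda Crosses C =
      6 * (P.hCount : ℤ) - 6 * (P.tripleCount : ℤ) + 2 * (P.crossCount : ℤ) := by
    have e1 : ∑ c ∈ C, (3 * relDegree Crosses C c ^ 2 - 2 * relDegree Crosses C c) =
        3 * ∑ c ∈ C, (relDegree Crosses C c ^ 2 - relDegree Crosses C c) +
          ∑ c ∈ C, relDegree Crosses C c := by
      rw [Finset.mul_sum, ← Finset.sum_add_distrib]
      exact Finset.sum_congr rfl fun c _ => by ring
    have e2 : ∑ c ∈ C, relDegree Crosses C c = 2 * (P.crossCount : ℤ) := h1.symm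
    change 6 * (P.tripleCount : ℤ) = _ at h2
    change 2 * (P.hCount : ℤ) = _ at h3
    rw [eightLambda, e1, e2, ← h2]
    rw [← h2] at h3
    linear_combination -3 * h3
  rw [lambdaInv, h4]
  push_cast
  ring

/-- `λ` is an integer: if a vertex has degree `2 k`, then `3 (2 k)² - 2 (2 k) = 4 k (3 k - 1)` is
divisible by `8`. -/
theorem exists_lambdaInv_eq_intCast (P : KnotProjection) : ∃ n : ℤ, P.lambdaInv = (n : ℚ) := by
  have hfin : P.chords.Finite := P.finite_double
  suffices h : (8 : ℤ) ∣ chordLambda P.chords by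
    obtain ⟨n, hn⟩ := h
    refine ⟨n, ?_⟩
    rw [lambdaInv_eq, hn]
    push_cast
    ring
  rw [chordLambda, dif_pos hfin]
  refine dvd_sub (Finset.dvd_sum fun c hc => ?_) ?_
  · have heven := P.even_crossing_chords (hfin.mem_toFinset.1 hc)
    have hdeg : relDegree Crosses hfin.toFinset c =
        ({d | d ∈ P.chords ∧ Crosses c d}.ncard : ℤ) := by
      classical
      simp only [relDegree, ind]
      rw [← Finset.natCast_card_filter, ← Set.ncard_coe_finset]
      simp
    obtain ⟨k, hk⟩ := heven
    rw [hdeg, hk]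
    obtain ⟨m, hm⟩ : Even ((k : ℤ) * (3 * k - 1)) := by
      rcases Int.even_or_odd (k : ℤ) with h | h
      · exact h.mul_right _
      · refine Even.mul_left ?_ _
        obtain ⟨j, hj⟩ := h
        exact ⟨3 * j + 1, by rw [hj]; ring⟩
    exact ⟨m, by push_cast; linear_combination 4 * hm⟩
  · rw [← six_mul_ncard_triangles crosses_symm not_crosses_self]
    exact ⟨3 * _, by ring⟩

/-! ### Independence of the parametrization -/

/-- The chords of the chord diagram of a `1`-periodic curve, with parameters in the fundamental
domain `[a, a + 1)`. -/
def chordsFrom {X : Type*} (f : ℝ → X) (a : ℝ) : Set (ℝ × ℝ) :=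
  {c | a ≤ c.1 ∧ c.1 < c.2 ∧ c.2 < a + 1 ∧ f c.1 = f c.2}

lemma chords_eq_chordsFrom (P : KnotProjection) : P.chords = chordsFrom P.toFun 0 := by
  simp [chords, chordsFrom]

section Periodic

variable {X Y : Type*} {f : ℝ → X} {g : ℝ → Y}

lemma chordLambda_chordsFrom_of_orderIso (ρ : ℝ ≃o ℝ) {a b : ℝ} (ha : ρ a = b)
    (ha1 : ρ (a + 1) = b + 1) (hfg : ∀ s t, g (ρ s) = g (ρ t) ↔ f s = f t) :
    chordLambda (chordsFrom f a) = chordLambda (chordsFrom g b) := by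
  refine chordLambda_eq_of_bijOn (i := fun c => (ρ c.1, ρ c.2)) ⟨?_, ?_, ?_⟩ ?_
  · rintro ⟨s, t⟩ ⟨h1, h2, h3, h4⟩
    exact ⟨ha ▸ ρ.monotone h1, ρ.strictMono h2, ha1 ▸ ρ.strictMono h3, (hfg s t).2 h4⟩
  · rintro ⟨s, t⟩ - ⟨s', t'⟩ - h
    simpa using h
  · rintro ⟨s, t⟩ ⟨h1, h2, h3, h4⟩
    simp only at h1 h2 h3 h4
    refine ⟨(ρ.symm s, ρ.symm t), ⟨?_, ρ.symm.strictMono h2, ?_, ?_⟩, by simp⟩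
    · rwa [ρ.le_symm_apply, ha]
    · rwa [ρ.symm_apply_lt, ha1]
    · rwa [← hfg, ρ.apply_symm_apply, ρ.apply_symm_apply]
  · rintro ⟨s, t⟩ - ⟨s', t'⟩ -
    simp [Crosses]

/-- Moving the base point from `a` to `b` adds `1` to the parameters in `[a, b)`. -/
lemma chordLambda_chordsFrom_base (hf : ∀ t, f (t + 1) = f t) {a b : ℝ} (hab : a ≤ b)
    (hba : b ≤ a + 1) : chordLambda (chordsFrom f a) = chordLambda (chordsFrom f b) := by
  refine chordLambda_eq_of_bijOn (i := fun c => if b ≤ c.1 then c else if b ≤ c.2 then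
    (c.2, c.1 + 1) else (c.1 + 1, c.2 + 1)) ⟨?_, ?_, ?_⟩ ?_
  · rintro ⟨s, t⟩ ⟨h1, h2, h3, h4⟩
    simp only at h1 h2 h3 h4 ⊢
    split_ifs with h h'
    · exact ⟨h, h2, by simp only; linarith, h4⟩
    · exact ⟨h', by simp only; linarith, by simp only; linarith, by simp only [hf, h4]⟩
    · exact ⟨by simp only; linarith, by simp only; linarith, by simp only; linarith,
        by simp only [hf, h4]⟩
  · rintro ⟨s, t⟩ ⟨h1, h2, h3, -⟩ ⟨s', t'⟩ ⟨h1', h2', h3', -⟩ h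
    simp only at h1 h2 h3 h1' h2' h3' h
    grind
  · rintro ⟨s, t⟩ ⟨h1, h2, h3, h4⟩
    simp only at h1 h2 h3 h4
    have hf' : ∀ t, f (t - 1) = f t := fun t => by rw [← hf, sub_add_cancel]
    rcases lt_or_ge t (a + 1) with h | h
    · exact ⟨(s, t), ⟨by simp only; linarith, h2, h, h4⟩, by simp [h1]⟩
    · rcases lt_or_ge s (a + 1) with h' | h'
      · refine ⟨(t - 1, s), ⟨by simp only; linarith, by simp only; linarith, h',
          by simp only [hf', h4]⟩, ?_⟩
        simp [h1, show ¬ b ≤ t - 1 by linarith]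
      · refine ⟨(s - 1, t - 1), ⟨by simp only; linarith, by simp only; linarith,
          by simp only; linarith, by simp only [hf', h4]⟩, ?_⟩
        simp [show ¬ b ≤ t - 1 by linarith, show ¬ b ≤ s - 1 by linarith]
  · rintro ⟨s, t⟩ ⟨h1, h2, h3, -⟩ ⟨s', t'⟩ ⟨h1', h2', h3', -⟩
    simp only at h1 h2 h3 h1' h2' h3' ⊢
    simp only [Crosses]
    split_ifs <;> grind

/-- The invariant of the chord diagram does not depend on the base point of the circle. -/
lemma chordLambda_chordsFrom (hf : ∀ t, f (t + 1) = f t) (a b : ℝ) :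
    chordLambda (chordsFrom f a) = chordLambda (chordsFrom f b) := by
  suffices h : ∀ a, chordLambda (chordsFrom f a) = chordLambda (chordsFrom f 0) by
    rw [h a, h b]
  intro a
  rw [chordLambda_chordsFrom_base hf (Int.fract_nonneg a) (by
    have := Int.fract_lt_one a; linarith)]
  have hp : Function.Periodic f 1 := hf
  refine (chordLambda_chordsFrom_of_orderIso (OrderIso.addRight (⌊a⌋ : ℝ)) ?_ ?_ fun s t => ?_).symm
  · simp
  · simp only [OrderIso.addRight_apply]; linarith [Int.fract_add_floor a]
  · have := hp.int_mul ⌊a⌋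
    rw [mul_one] at this
    simp only [OrderIso.addRight_apply]
    rw [this, this]

/-- Reversing the circle. The base point is not the end of a chord, so that it does not matter
which end of the fundamental domain is included. -/
lemma chordLambda_chordsFrom_of_antitone (ρ : ℝ ≃ₜ ℝ) (hρ : StrictAnti ρ) {a : ℝ}
    (ha1 : ρ (a + 1) = ρ a - 1) (hf : ∀ t, f (t + 1) = f t)
    (hfg : ∀ s t, g (ρ s) = g (ρ t) ↔ f s = f t) (ha : ∀ t ∈ Ioo a (a + 1), f t ≠ f a) :
    chordLambda (chordsFrom f a) = chordLambda (chordsFrom g (ρ (a + 1))) := by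
  refine chordLambda_eq_of_bijOn (i := fun c => (ρ c.2, ρ c.1)) ⟨?_, ?_, ?_⟩ ?_
  · rintro ⟨s, t⟩ ⟨h1, h2, h3, h4⟩
    simp only at h1 h2 h3 h4
    have hs : a < s := h1.lt_of_ne (by rintro rfl; exact ha t ⟨h2, h3⟩ h4.symm)
    refine ⟨(hρ h3).le, hρ h2, ?_, (hfg t s).2 h4.symm⟩
    simpa [ha1] using hρ hs
  · rintro ⟨s, t⟩ - ⟨s', t'⟩ - h
    simp only [Prod.mk.injEq, EmbeddingLike.apply_eq_iff_eq] at h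
    simp [h]
  · rintro ⟨x, y⟩ ⟨h1, h2, h3, h4⟩
    obtain ⟨t, rfl⟩ := ρ.surjective x
    obtain ⟨s, rfl⟩ := ρ.surjective y
    simp only [ha1, sub_add_cancel] at h1 h2 h3 h4
    rw [← ha1] at h1
    have h1' := hρ.le_iff_ge.1 h1
    have h2' := hρ.lt_iff_gt.1 h2
    have h3' := hρ.lt_iff_gt.1 h3
    have h4' := (hfg t s).1 h4
    refine ⟨(s, t), ⟨h3'.le, h2', h1'.lt_of_ne ?_, h4'.symm⟩, rfl⟩
    rintro rfl
    exact ha s ⟨h3', h2'⟩ (by rw [← h4', hf])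
  · rintro ⟨s, t⟩ - ⟨s', t'⟩ -
    simp only [Crosses, hρ.lt_iff_gt]
    tauto

end Periodic

lemma lambdaInv_eq_chordsFrom (P : KnotProjection) (a : ℝ) :
    P.lambdaInv = (chordLambda (chordsFrom P.toFun a) : ℚ) / 8 := by
  rw [lambdaInv_eq, chords_eq_chordsFrom, chordLambda_chordsFrom P.periodic 0 a]

lemma exists_simple_base (P : KnotProjection) :
    ∃ a, ∀ t ∈ Ioo a (a + 1), P.toFun t ≠ P.toFun a := by
  have hfin : P.chords.Finite := P.finite_double
  obtain ⟨a, ha, hna⟩ := (Ioo_infinite (zero_lt_one' ℝ)).exists_notMem_finite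
    ((hfin.image Prod.fst).union (hfin.image Prod.snd))
  refine ⟨a, fun t ht he => hna ?_⟩
  rcases lt_or_ge t 1 with h | h
  · exact Or.inl ⟨(a, t), ⟨ha.1.le, ht.1, h, he.symm⟩, rfl⟩
  · refine Or.inr ⟨(t - 1, a), ⟨by simp only; linarith, by simp only; linarith [ht.2], ha.2, ?_⟩,
      rfl⟩
    simp only
    rw [← he, ← P.periodic, sub_add_cancel]

/-- `λ` depends only on the curve up to homeomorphisms of the sphere and reparametrization. -/
theorem Equivalent.lambdaInv_eq {P Q : KnotProjection} (h : Equivalent P Q) :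
    P.lambdaInv = Q.lambdaInv := by
  obtain ⟨h, ρ, hρ, hPQ⟩ := h
  have hfg : ∀ s t, Q.toFun (ρ s) = Q.toFun (ρ t) ↔ P.toFun s = P.toFun t := fun s t => by
    rw [hPQ, hPQ, h.injective.eq_iff]
  rcases ρ.continuous.strictMono_of_inj ρ.injective with hm | hm
  · rcases hρ with hρ | hρ
    · rw [P.lambdaInv_eq_chordsFrom 0, Q.lambdaInv_eq_chordsFrom (ρ 0),
        chordLambda_chordsFrom_of_orderIso (g := Q.toFun) (hm.orderIsoOfSurjective ρ ρ.surjective)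
          rfl (hρ 0) hfg]
      rfl
    · have := hm (show (0 : ℝ) < 0 + 1 by norm_num)
      rw [hρ] at this
      linarith
  · rcases hρ with hρ | hρ
    · have := hm (show (0 : ℝ) < 0 + 1 by norm_num)
      rw [hρ] at this
      linarith
    · obtain ⟨a, ha⟩ := P.exists_simple_base
      rw [P.lambdaInv_eq_chordsFrom a, Q.lambdaInv_eq_chordsFrom (ρ (a + 1)),
        chordLambda_chordsFrom_of_antitone ρ hm (hρ a) P.periodic hfg ha]

end KnotProjection

/-! ### The first Reidemeister move -/

namespace KnotProjection

lemma RunsAlong.exists_param {P : KnotProjection} {a b : ℝ} {φ : ℂ → S2} {α : ℝ → ℂ}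
    (h : RunsAlong P a b φ α) (hab : a < b) : ∃ θ : ℝ → ℝ, StrictMonoOn θ (Icc a b) ∧
      BijOn θ (Icc a b) (Icc (-1) 1) ∧ ∀ t ∈ Icc a b, P.toFun t = φ (α (θ t)) := by
  obtain ⟨θ, hc, hm, h1, h2, h3⟩ := h
  refine ⟨θ, hm, ⟨fun t ht => ⟨?_, ?_⟩, hm.injOn, ?_⟩, h3⟩
  · rw [← h1]; exact hm.monotoneOn (left_mem_Icc.2 hab.le) ht ht.1
  · rw [← h2]; exact hm.monotoneOn ht (right_mem_Icc.2 hab.le) ht.2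
  · have := intermediate_value_Icc hab.le hc
    rwa [h1, h2] at this

lemma plainArc_mem {s : ℝ} (hs : s ∈ Icc (-1 : ℝ) 1) : plainArc s ∈ Metric.closedBall (0 : ℂ) 1 := by
  rw [mem_closedBall_zero_iff, ← sq_le_one_iff₀ (norm_nonneg _), ← Complex.normSq_eq_norm_sq,
    Complex.normSq_apply]
  simp only [plainArc]
  nlinarith [hs.1, hs.2]

lemma kinkArc_mem {s : ℝ} (hs : s ∈ Icc (-1 : ℝ) 1) : kinkArc s ∈ Metric.closedBall (0 : ℂ) 1 := by
  rw [mem_closedBall_zero_iff, ← sq_le_one_iff₀ (norm_nonneg _), ← Complex.normSq_eq_norm_sq,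
    Complex.normSq_apply]
  simp only [kinkArc]
  have h0 : 0 ≤ s ^ 2 := sq_nonneg s
  have h1 : s ^ 2 ≤ 1 := by nlinarith [hs.1, hs.2]
  -- With `u = s²`, use `(4 u - 1)² ≤ 9` and `(1 - u)² ≤ 1 - u`.
  have h2 : (4 * s ^ 2 - 1) ^ 2 ≤ 9 := by nlinarith
  have h3 : s ^ 2 * (4 * s ^ 2 - 1) ^ 2 ≤ s ^ 2 * 9 := mul_le_mul_of_nonneg_left h2 h0
  nlinarith

lemma kinkArc_eq_iff {s t : ℝ} (hst : s < t) : kinkArc s = kinkArc t ↔ s = -1 / 2 ∧ t = 1 / 2 := by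
  simp only [kinkArc, Complex.mk.injEq]
  constructor
  · rintro ⟨h1, h2⟩
    have h3 : (s - t) * (s + t) = 0 := by linarith
    have h4 : s = -t := by
      rcases mul_eq_zero.1 h3 with h | h <;> linarith
    subst h4
    have h5 : t * ((2 * t - 1) * (2 * t + 1)) = 0 := by linarith
    rcases mul_eq_zero.1 h5 with h | h
    · linarith
    · rcases mul_eq_zero.1 h with h | h <;> constructor <;> linarith
  · rintro ⟨rfl, rfl⟩
    norm_num

/-- An RI move adds one isolated chord. -/
theorem RI.lambdaInv_eq {P Q : KnotProjection} (h : RI P Q) : P.lambdaInv = Q.lambdaInv := by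
  obtain ⟨φ, ψ, a, b, ⟨-, hφ, -, hψ, himg, -⟩, hab, hba, hP, hQ, hout⟩ := h
  obtain ⟨θ, -, hθ, hPθ⟩ := hP.exists_param hab
  obtain ⟨η, hη', hη, hQη⟩ := hQ.exists_param hab
  rw [P.lambdaInv_eq_chordsFrom a, Q.lambdaInv_eq_chordsFrom a]
  have hPin : ∀ t ∈ Icc a b, P.toFun t ∈ φ '' Metric.closedBall 0 1 := fun t ht =>
    ⟨_, plainArc_mem (hθ.mapsTo ht), (hPθ t ht).symm⟩
  have hQin : ∀ t ∈ Icc a b, Q.toFun t ∈ φ '' Metric.closedBall 0 1 := fun t ht => by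
    rw [himg]; exact ⟨_, kinkArc_mem (hη.mapsTo ht), (hQη t ht).symm⟩
  have hQout : ∀ t ∈ Ioo b (a + 1), Q.toFun t ∉ φ '' Metric.closedBall 0 1 := fun t ht => by
    rw [← (hout t ht).1]; exact (hout t ht).2
  have hcases : ∀ t, a ≤ t → t < a + 1 → t ∈ Icc a b ∨ t ∈ Ioo b (a + 1) := fun t h1 h2 => by
    rcases le_or_gt t b with h | h
    · exact Or.inl ⟨h1, h⟩
    · exact Or.inr ⟨h, h2⟩
  obtain ⟨k₁, hk₁, e₁⟩ := hη.surjOn (show (-1 / 2 : ℝ) ∈ Icc (-1 : ℝ) 1 by norm_num)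
  obtain ⟨k₂, hk₂, e₂⟩ := hη.surjOn (show (1 / 2 : ℝ) ∈ Icc (-1 : ℝ) 1 by norm_num)
  have hk : k₁ < k₂ := by
    rw [← hη'.lt_iff_lt hk₁ hk₂, e₁, e₂]; norm_num
  have hPo : ∀ c ∈ chordsFrom P.toFun a, b < c.1 ∧ b < c.2 := by
    rintro ⟨s, t⟩ ⟨h1, h2, h3, h4⟩
    simp only at h1 h2 h3 h4 ⊢
    rcases hcases s h1 (by linarith) with hs | hs <;> rcases hcases t (by linarith) h3 with ht | ht
    · rw [hPθ s hs, hPθ t ht] at h4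
      have := hφ (plainArc_mem (hθ.mapsTo hs)) (plainArc_mem (hθ.mapsTo ht)) h4
      simp only [plainArc, Complex.mk.injEq, and_true] at this
      exact absurd (hθ.injOn hs ht this) h2.ne
    · exact absurd (h4 ▸ hPin s hs) (hout t ht).2
    · exact absurd (h4 ▸ hPin t ht) (hout s hs).2
    · exact ⟨hs.1, ht.1⟩
  have hQeq : chordsFrom Q.toFun a = insert (k₁, k₂) (chordsFrom P.toFun a) := by
    ext ⟨s, t⟩
    rw [mem_insert_iff, Prod.mk.injEq]
    constructor
    · rintro ⟨h1, h2, h3, h4⟩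
      simp only at h1 h2 h3 h4
      rcases hcases s h1 (by linarith) with hs | hs <;> rcases hcases t (by linarith) h3 with ht | ht
      · rw [hQη s hs, hQη t ht] at h4
        have := hψ (kinkArc_mem (hη.mapsTo hs)) (kinkArc_mem (hη.mapsTo ht)) h4
        rw [kinkArc_eq_iff (hη' hs ht h2), ← e₁, ← e₂] at this
        exact Or.inl ⟨hη.injOn hs hk₁ this.1, hη.injOn ht hk₂ this.2⟩
      · exact absurd (h4 ▸ hQin s hs) (hQout t ht)
      · exact absurd (h4 ▸ hQin t ht) (hQout s hs)
      · exact Or.inr ⟨h1, h2, h3, by simp only [(hout s hs).1, (hout t ht).1, h4]⟩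
    · rintro (⟨rfl, rfl⟩ | hc)
      · refine ⟨hk₁.1, hk, by simp only; linarith [hk₂.2], ?_⟩
        simp only [hQη _ hk₁, hQη _ hk₂, e₁, e₂]
        rw [(kinkArc_eq_iff (by norm_num)).2 ⟨rfl, rfl⟩]
      · obtain ⟨hs, ht⟩ := hPo _ hc
        obtain ⟨h1, h2, h3, h4⟩ := hc
        simp only at h1 h2 h3 h4 hs ht
        refine ⟨h1, h2, h3, ?_⟩
        simp only
        rw [← (hout s ⟨hs, by linarith⟩).1, ← (hout t ⟨ht, h3⟩).1, h4]
  have hnot : (k₁, k₂) ∉ chordsFrom P.toFun a := fun hc => by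
    have := (hPo _ hc).1
    simp only at this
    linarith [hk₁.2]
  rw [hQeq]
  congr 2
  by_cases hfin : (chordsFrom P.toFun a).Finite
  · obtain ⟨C, hC⟩ := hfin.exists_finset_coe
    classical
    rw [← hC, ← Finset.coe_insert, chordLambda_coe, chordLambda_coe]
    refine (eightLambda_insert_isolated crosses_symm not_crosses_self ?_ fun c hc => ?_).symm
    · rwa [← Finset.mem_coe, hC]
    · rw [← Finset.mem_coe, hC] at hc
      have := hPo c hc
      simp only [Crosses]
      rintro (h | h) <;> linarith [hk₁.2, hk₂.2]
  · rw [chordLambda, chordLambda, dif_neg hfin, dif_neg (by rwa [finite_insert])]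

/-! ### The strong third Reidemeister move -/

/-- The chords of a curve that meets a disc in three simple branches any two of which cross exactly
once: three chords inside the disc, and the chords `O` of the outer part of the curve. The numbers
`pᵢⱼ` are the parameters of the crossing of the branches `i` and `j` on the model arc `αᵢ`. -/
lemma chordsFrom_eq_insert_of_branches {R : KnotProjection} {χ : ℂ → S2}
    (hχ : InjOn χ (Metric.closedBall 0 1)) {a b c d e f : ℝ} (hab : a < b) (hbc : b < c)
    (hcd : c < d) (hde : d < e) (hef : e < f) (hfa : f < a + 1) {α₁ α₂ α₃ : ℝ → ℂ}
    (h₁ : RunsAlong R a b χ α₁) (h₂ : RunsAlong R c d χ α₂) (h₃ : RunsAlong R e f χ α₃)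
    (m₁ : MapsTo α₁ (Icc (-1) 1) (Metric.closedBall 0 1))
    (m₂ : MapsTo α₂ (Icc (-1) 1) (Metric.closedBall 0 1))
    (m₃ : MapsTo α₃ (Icc (-1) 1) (Metric.closedBall 0 1))
    (i₁ : InjOn α₁ (Icc (-1) 1)) (i₂ : InjOn α₂ (Icc (-1) 1)) (i₃ : InjOn α₃ (Icc (-1) 1))
    {p₁₂ p₂₁ p₁₃ p₃₁ p₂₃ p₃₂ : ℝ}
    (q₁₂ : p₁₂ ∈ Icc (-1 : ℝ) 1) (q₂₁ : p₂₁ ∈ Icc (-1 : ℝ) 1) (q₁₃ : p₁₃ ∈ Icc (-1 : ℝ) 1)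
    (q₃₁ : p₃₁ ∈ Icc (-1 : ℝ) 1) (q₂₃ : p₂₃ ∈ Icc (-1 : ℝ) 1) (q₃₂ : p₃₂ ∈ Icc (-1 : ℝ) 1)
    (c₁₂ : ∀ s ∈ Icc (-1 : ℝ) 1, ∀ t ∈ Icc (-1 : ℝ) 1, α₁ s = α₂ t ↔ s = p₁₂ ∧ t = p₂₁)
    (c₁₃ : ∀ s ∈ Icc (-1 : ℝ) 1, ∀ t ∈ Icc (-1 : ℝ) 1, α₁ s = α₃ t ↔ s = p₁₃ ∧ t = p₃₁)
    (c₂₃ : ∀ s ∈ Icc (-1 : ℝ) 1, ∀ t ∈ Icc (-1 : ℝ) 1, α₂ s = α₃ t ↔ s = p₂₃ ∧ t = p₃₂)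
    (hout : ∀ t ∈ Ioo b c ∪ Ioo d e ∪ Ioo f (a + 1), R.toFun t ∉ χ '' Metric.closedBall 0 1) :
    ∃ x₁₂ ∈ Icc a b, ∃ x₁₃ ∈ Icc a b, ∃ x₂₁ ∈ Icc c d, ∃ x₂₃ ∈ Icc c d, ∃ x₃₁ ∈ Icc e f,
      ∃ x₃₂ ∈ Icc e f, (x₁₂ < x₁₃ ↔ p₁₂ < p₁₃) ∧ (x₁₃ < x₁₂ ↔ p₁₃ < p₁₂) ∧
      (x₂₁ < x₂₃ ↔ p₂₁ < p₂₃) ∧ (x₂₃ < x₂₁ ↔ p₂₃ < p₂₁) ∧ (x₃₁ < x₃₂ ↔ p₃₁ < p₃₂) ∧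
      (x₃₂ < x₃₁ ↔ p₃₂ < p₃₁) ∧
      chordsFrom R.toFun a = insert (x₂₃, x₃₂) (insert (x₁₃, x₃₁) (insert (x₁₂, x₂₁)
        {z | z ∈ chordsFrom R.toFun a ∧ z.1 ∈ Ioo b c ∪ Ioo d e ∪ Ioo f (a + 1) ∧
          z.2 ∈ Ioo b c ∪ Ioo d e ∪ Ioo f (a + 1)})) := by
  obtain ⟨θ₁, s₁, b₁, e₁⟩ := h₁.exists_param hab
  obtain ⟨θ₂, s₂, b₂, e₂⟩ := h₂.exists_param hcd
  obtain ⟨θ₃, s₃, b₃, e₃⟩ := h₃.exists_param hef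
  obtain ⟨x₁₂, k₁₂, t₁₂⟩ := b₁.surjOn q₁₂
  obtain ⟨x₁₃, k₁₃, t₁₃⟩ := b₁.surjOn q₁₃
  obtain ⟨x₂₁, k₂₁, t₂₁⟩ := b₂.surjOn q₂₁
  obtain ⟨x₂₃, k₂₃, t₂₃⟩ := b₂.surjOn q₂₃
  obtain ⟨x₃₁, k₃₁, t₃₁⟩ := b₃.surjOn q₃₁
  obtain ⟨x₃₂, k₃₂, t₃₂⟩ := b₃.surjOn q₃₂
  refine ⟨x₁₂, k₁₂, x₁₃, k₁₃, x₂₁, k₂₁, x₂₃, k₂₃, x₃₁, k₃₁, x₃₂, k₃₂, ?_, ?_, ?_, ?_, ?_, ?_, ?_⟩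
  · rw [← s₁.lt_iff_lt k₁₂ k₁₃, t₁₂, t₁₃]
  · rw [← s₁.lt_iff_lt k₁₃ k₁₂, t₁₂, t₁₃]
  · rw [← s₂.lt_iff_lt k₂₁ k₂₃, t₂₁, t₂₃]
  · rw [← s₂.lt_iff_lt k₂₃ k₂₁, t₂₁, t₂₃]
  · rw [← s₃.lt_iff_lt k₃₁ k₃₂, t₃₁, t₃₂]
  · rw [← s₃.lt_iff_lt k₃₂ k₃₁, t₃₁, t₃₂]
  -- A branch meets itself only trivially, and two branches only in the given crossing.
  have self : ∀ {x y : ℝ} {α : ℝ → ℂ} {θ : ℝ → ℝ}, BijOn θ (Icc x y) (Icc (-1) 1) →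
      MapsTo α (Icc (-1) 1) (Metric.closedBall 0 1) → InjOn α (Icc (-1) 1) →
      (∀ t ∈ Icc x y, R.toFun t = χ (α (θ t))) → ∀ s ∈ Icc x y, ∀ t ∈ Icc x y,
      R.toFun s = R.toFun t → s = t := by
    intro x y α θ hb hm hi he s hs t ht hst
    rw [he s hs, he t ht] at hst
    exact hb.injOn hs ht (hi (hb.mapsTo hs) (hb.mapsTo ht)
      (hχ (hm (hb.mapsTo hs)) (hm (hb.mapsTo ht)) hst))
  have cross : ∀ {x y x' y' p p' u u' : ℝ} {α α' : ℝ → ℂ} {θ θ' : ℝ → ℝ},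
      BijOn θ (Icc x y) (Icc (-1) 1) → BijOn θ' (Icc x' y') (Icc (-1) 1) →
      MapsTo α (Icc (-1) 1) (Metric.closedBall 0 1) →
      MapsTo α' (Icc (-1) 1) (Metric.closedBall 0 1) →
      (∀ t ∈ Icc x y, R.toFun t = χ (α (θ t))) → (∀ t ∈ Icc x' y', R.toFun t = χ (α' (θ' t))) →
      (∀ s ∈ Icc (-1 : ℝ) 1, ∀ t ∈ Icc (-1 : ℝ) 1, α s = α' t ↔ s = p ∧ t = p') →
      u ∈ Icc x y → u' ∈ Icc x' y' → θ u = p → θ' u' = p' →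
      ∀ s ∈ Icc x y, ∀ t ∈ Icc x' y', (R.toFun s = R.toFun t ↔ s = u ∧ t = u') := by
    intro x y x' y' p p' u u' α α' θ θ' hb hb' hm hm' he he' hc hu hu' hp hp' s hs t ht
    rw [he s hs, he' t ht, hχ.eq_iff (hm (hb.mapsTo hs)) (hm' (hb'.mapsTo ht)),
      hc _ (hb.mapsTo hs) _ (hb'.mapsTo ht), ← hp, ← hp', hb.injOn.eq_iff hs hu,
      hb'.injOn.eq_iff ht hu']
  have cr₁₂ := cross b₁ b₂ m₁ m₂ e₁ e₂ c₁₂ k₁₂ k₂₁ t₁₂ t₂₁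
  have cr₁₃ := cross b₁ b₃ m₁ m₃ e₁ e₃ c₁₃ k₁₃ k₃₁ t₁₃ t₃₁
  have cr₂₃ := cross b₂ b₃ m₂ m₃ e₂ e₃ c₂₃ k₂₃ k₃₂ t₂₃ t₃₂
  have se₁ := self b₁ m₁ i₁ e₁
  have se₂ := self b₂ m₂ i₂ e₂
  have se₃ := self b₃ m₃ i₃ e₃
  have hin : ∀ t ∈ Icc a b ∪ Icc c d ∪ Icc e f, R.toFun t ∈ χ '' Metric.closedBall 0 1 := by
    rintro t ((ht | ht) | ht)
    · exact ⟨_, m₁ (b₁.mapsTo ht), (e₁ t ht).symm⟩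
    · exact ⟨_, m₂ (b₂.mapsTo ht), (e₂ t ht).symm⟩
    · exact ⟨_, m₃ (b₃.mapsTo ht), (e₃ t ht).symm⟩
  have hcases : ∀ t, a ≤ t → t < a + 1 → t ∈ Icc a b ∪ Icc c d ∪ Icc e f ∨
      t ∈ Ioo b c ∪ Ioo d e ∪ Ioo f (a + 1) := by
    intro t h1 h2
    simp only [mem_union, mem_Icc, mem_Ioo]
    grind
  ext ⟨s, t⟩
  simp only [mem_insert_iff, Prod.mk.injEq]
  constructor
  · intro hz
    obtain ⟨h1, h2, h3, h4⟩ := id hz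
    simp only at h1 h2 h3 h4
    rcases hcases s h1 (by linarith) with hs | hs <;> rcases hcases t (by linarith) h3 with ht | ht
    · rcases hs with (hs | hs) | hs <;> rcases ht with (ht | ht) | ht
      · exact absurd (se₁ s hs t ht h4) h2.ne
      · exact Or.inr (Or.inr (Or.inl ((cr₁₂ s hs t ht).1 h4)))
      · exact Or.inr (Or.inl ((cr₁₃ s hs t ht).1 h4))
      · linarith [hs.1, ht.2]
      · exact absurd (se₂ s hs t ht h4) h2.ne
      · exact Or.inl ((cr₂₃ s hs t ht).1 h4)
      · linarith [hs.1, ht.2]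
      · linarith [hs.1, ht.2]
      · exact absurd (se₃ s hs t ht h4) h2.ne
    · exact absurd (h4 ▸ hin s hs) (hout t ht)
    · exact absurd (h4 ▸ hin t ht) (hout s hs)
    · exact Or.inr (Or.inr (Or.inr ⟨hz, hs, ht⟩))
  · rintro (⟨rfl, rfl⟩ | ⟨rfl, rfl⟩ | ⟨rfl, rfl⟩ | hz)
    · exact ⟨by linarith [k₂₃.1], by simp only; linarith [k₂₃.2, k₃₂.1],
        by simp only; linarith [k₃₂.2], (cr₂₃ _ k₂₃ _ k₃₂).2 ⟨rfl, rfl⟩⟩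
    · exact ⟨k₁₃.1, by simp only; linarith [k₁₃.2, k₃₁.1],
        by simp only; linarith [k₃₁.2], (cr₁₃ _ k₁₃ _ k₃₁).2 ⟨rfl, rfl⟩⟩
    · exact ⟨k₁₂.1, by simp only; linarith [k₁₂.2, k₂₁.1],
        by simp only; linarith [k₂₁.2], (cr₁₂ _ k₁₂ _ k₂₁).2 ⟨rfl, rfl⟩⟩
    · exact hz.1

lemma mem_closedBall_of_sq_add_sq {x y : ℝ} (h : x ^ 2 + y ^ 2 ≤ 1) :
    (⟨x, y⟩ : ℂ) ∈ Metric.closedBall (0 : ℂ) 1 := by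
  rw [mem_closedBall_zero_iff, ← sq_le_one_iff₀ (norm_nonneg _), ← Complex.normSq_eq_norm_sq,
    Complex.normSq_apply]
  simpa [sq] using h

lemma branches_mapsTo : MapsTo branchUpper (Icc (-1) 1) (Metric.closedBall 0 1) ∧
    MapsTo branchLower (Icc (-1) 1) (Metric.closedBall 0 1) ∧
    MapsTo branchNWSE (Icc (-1) 1) (Metric.closedBall 0 1) ∧
    MapsTo branchSWNE (Icc (-1) 1) (Metric.closedBall 0 1) := by
  refine ⟨?_, ?_, ?_, ?_⟩ <;> intro s hs <;> refine mem_closedBall_of_sq_add_sq ?_ <;>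
    have h1 : s ^ 2 ≤ 1 := by nlinarith [hs.1, hs.2]
  · nlinarith [sq_nonneg s]
  · nlinarith [sq_nonneg s]
  · nlinarith
  · nlinarith

lemma branches_injOn : InjOn branchUpper (Icc (-1) 1) ∧ InjOn branchLower (Icc (-1) 1) ∧
    InjOn branchNWSE (Icc (-1) 1) ∧ InjOn branchSWNE (Icc (-1) 1) := by
  refine ⟨?_, ?_, ?_, ?_⟩ <;> intro s _ t _ h <;> have := congrArg Complex.re h <;>
    simp only [branchUpper, branchLower, branchNWSE, branchSWNE] at this <;> linarith

lemma branchUpper_eq_branchNWSE {s t : ℝ} (hs : s ∈ Icc (-1 : ℝ) 1) :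
    branchUpper s = branchNWSE t ↔ s = 1 / 3 ∧ t = -5 / 9 := by
  simp only [branchUpper, branchNWSE, Complex.mk.injEq]
  constructor
  · rintro ⟨h1, h2⟩
    have h3 : (3 * s - 1) * (s + 3) = 0 := by linarith
    rcases mul_eq_zero.1 h3 with h | h
    · constructor <;> linarith
    · linarith [hs.1]
  · rintro ⟨rfl, rfl⟩; norm_num

lemma branchUpper_eq_branchSWNE {s t : ℝ} (hs : s ∈ Icc (-1 : ℝ) 1) :
    branchUpper s = branchSWNE t ↔ s = -1 / 3 ∧ t = 5 / 9 := by
  simp only [branchUpper, branchSWNE, Complex.mk.injEq]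
  constructor
  · rintro ⟨h1, h2⟩
    have h3 : (3 * s + 1) * (s - 3) = 0 := by linarith
    rcases mul_eq_zero.1 h3 with h | h
    · constructor <;> linarith
    · linarith [hs.2]
  · rintro ⟨rfl, rfl⟩; norm_num

lemma branchLower_eq_branchNWSE {s t : ℝ} (hs : s ∈ Icc (-1 : ℝ) 1) :
    branchLower s = branchNWSE t ↔ s = -1 / 3 ∧ t = 5 / 9 := by
  simp only [branchLower, branchNWSE, Complex.mk.injEq]
  constructor
  · rintro ⟨h1, h2⟩
    have h3 : (3 * s + 1) * (s - 3) = 0 := by linarith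
    rcases mul_eq_zero.1 h3 with h | h
    · constructor <;> linarith
    · linarith [hs.2]
  · rintro ⟨rfl, rfl⟩; norm_num

lemma branchLower_eq_branchSWNE {s t : ℝ} (hs : s ∈ Icc (-1 : ℝ) 1) :
    branchLower s = branchSWNE t ↔ s = 1 / 3 ∧ t = -5 / 9 := by
  simp only [branchLower, branchSWNE, Complex.mk.injEq]
  constructor
  · rintro ⟨h1, h2⟩
    have h3 : (3 * s - 1) * (s + 3) = 0 := by linarith
    rcases mul_eq_zero.1 h3 with h | h
    · constructor <;> linarith
    · linarith [hs.1]
  · rintro ⟨rfl, rfl⟩; norm_num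

lemma branchNWSE_eq_branchSWNE {s t : ℝ} : branchNWSE s = branchSWNE t ↔ s = 0 ∧ t = 0 := by
  simp only [branchNWSE, branchSWNE, Complex.mk.injEq]
  constructor
  · rintro ⟨h1, h2⟩; constructor <;> linarith
  · rintro ⟨rfl, rfl⟩; norm_num

section OuterChords

variable {a b c d e f x y : ℝ} {o : ℝ × ℝ}

/-- A chord between the first two branches separates the arc `(b, c)` from the rest. -/
lemma crosses_first_second_iff (hx : x ∈ Icc a b) (hy : y ∈ Icc c d) (hcd : c < d)
    (hde : d < e) (hef : e < f) (ho : o.1 < o.2)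
    (h1 : o.1 ∈ Ioo b c ∪ Ioo d e ∪ Ioo f (a + 1)) (h2 : o.2 ∈ Ioo b c ∪ Ioo d e ∪ Ioo f (a + 1)) :
    Crosses (x, y) o ↔ o.1 < c ∧ d < o.2 := by
  simp only [Crosses, mem_union, mem_Icc, mem_Ioo] at *
  grind

/-- A chord between the first and the third branch separates the arc `(f, a + 1)` from the rest. -/
lemma crosses_first_third_iff (hx : x ∈ Icc a b) (hy : y ∈ Icc e f) (hbc : b < c) (hcd : c < d)
    (hde : d < e) (hef : e < f) (ho : o.1 < o.2)
    (h1 : o.1 ∈ Ioo b c ∪ Ioo d e ∪ Ioo f (a + 1)) (h2 : o.2 ∈ Ioo b c ∪ Ioo d e ∪ Ioo f (a + 1)) :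
    Crosses (x, y) o ↔ o.1 < e ∧ f < o.2 := by
  simp only [Crosses, mem_union, mem_Icc, mem_Ioo] at *
  grind

/-- A chord between the last two branches separates the arc `(d, e)` from the rest. -/
lemma crosses_second_third_iff (hx : x ∈ Icc c d) (hy : y ∈ Icc e f) (hcd : c < d)
    (hde : d < e) (hef : e < f) (ho : o.1 < o.2)
    (h1 : o.1 ∈ Ioo b c ∪ Ioo d e ∪ Ioo f (a + 1)) (h2 : o.2 ∈ Ioo b c ∪ Ioo d e ∪ Ioo f (a + 1)) :
    Crosses (x, y) o ↔ (o.1 < c ∧ d < o.2 ∧ o.2 < e) ∨ (d < o.1 ∧ o.1 < e ∧ f < o.2) := by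
  simp only [Crosses, mem_union, mem_Icc, mem_Ioo] at *
  grind

end OuterChords

/-- A strong RIII move turns three mutually non-crossing chords into three mutually crossing
ones. -/
theorem StrongRIII.lambdaInv_eq {P Q : KnotProjection} (h : StrongRIII P Q) :
    P.lambdaInv = Q.lambdaInv := by
  obtain ⟨φ, ψ, a, b, c, d, e, f, ⟨-, hφ, -, hψ, himg, -⟩, hab, hbc, hcd, hde, hef, hfa, hP₁, hP₂,
    hP₃, hQ₁, hQ₂, hQ₃, hout⟩ := h
  obtain ⟨mU, mL, mN, mS⟩ := branches_mapsTo
  obtain ⟨iU, iL, iN, iS⟩ := branches_injOn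
  obtain ⟨x₁₂, k₁₂, x₁₃, k₁₃, x₂₁, k₂₁, x₂₃, k₂₃, x₃₁, k₃₁, x₃₂, k₃₂, -, o₁, o₂, -, -, o₃, hP⟩ :=
    chordsFrom_eq_insert_of_branches hφ hab hbc hcd hde hef hfa hP₁ hP₂ hP₃ mU mN mS iU iN iS
      (by norm_num) (by norm_num) (by norm_num) (by norm_num) (by norm_num) (by norm_num)
      (fun s hs t _ => branchUpper_eq_branchNWSE hs) (fun s hs t _ => branchUpper_eq_branchSWNE hs)
      (fun s _ t _ => branchNWSE_eq_branchSWNE) (fun t ht => (hout t ht).2)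
  obtain ⟨y₁₂, l₁₂, y₁₃, l₁₃, y₂₁, l₂₁, y₂₃, l₂₃, y₃₁, l₃₁, y₃₂, l₃₂, u₁, -, -, u₂, u₃, -, hQ⟩ :=
    chordsFrom_eq_insert_of_branches hψ hab hbc hcd hde hef hfa hQ₁ hQ₂ hQ₃ mL mN mS iL iN iS
      (by norm_num) (by norm_num) (by norm_num) (by norm_num) (by norm_num) (by norm_num)
      (fun s hs t _ => branchLower_eq_branchNWSE hs) (fun s hs t _ => branchLower_eq_branchSWNE hs)
      (fun s _ t _ => branchNWSE_eq_branchSWNE)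
      (fun t ht => by rw [← (hout t ht).1, ← himg]; exact (hout t ht).2)
  -- The order of the crossings along the branches decides which of the three chords cross.
  replace o₁ := o₁.2 (by norm_num)
  replace o₂ := o₂.2 (by norm_num)
  replace o₃ := o₃.2 (by norm_num)
  replace u₁ := u₁.2 (by norm_num)
  replace u₂ := u₂.2 (by norm_num)
  replace u₃ := u₃.2 (by norm_num)
  rw [P.lambdaInv_eq_chordsFrom a, Q.lambdaInv_eq_chordsFrom a]
  set U := Ioo b c ∪ Ioo d e ∪ Ioo f (a + 1) with hU
  have hO : {z | z ∈ chordsFrom Q.toFun a ∧ z.1 ∈ U ∧ z.2 ∈ U} =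
      {z | z ∈ chordsFrom P.toFun a ∧ z.1 ∈ U ∧ z.2 ∈ U} := by
    ext ⟨s, t⟩
    refine and_congr_left fun ⟨hs, ht⟩ => ?_
    simp only [chordsFrom, mem_ofPred_eq, (hout s hs).1, (hout t ht).1]
  rw [hO] at hQ
  set O := {z | z ∈ chordsFrom P.toFun a ∧ z.1 ∈ U ∧ z.2 ∈ U} with hOdef
  rw [hP, hQ]
  congr 2
  by_cases hfin : O.Finite
  swap
  · rw [chordLambda, chordLambda, dif_neg (by simpa [finite_insert] using hfin),
      dif_neg (by simpa [finite_insert] using hfin)]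
  obtain ⟨C, hC⟩ := hfin.exists_finset_coe
  have hmem : ∀ o ∈ C, o.1 < o.2 ∧ o.1 ∈ U ∧ o.2 ∈ U := fun o ho => by
    rw [← Finset.mem_coe, hC] at ho
    exact ⟨ho.1.2.1, ho.2.1, ho.2.2⟩
  have hnot : ∀ x y, x ∈ Icc a b ∪ Icc c d → (x, y) ∉ C := fun x y hx ho => by
    have := (hmem _ ho).2.1
    simp only [hU, mem_union, mem_Icc, mem_Ioo] at this hx
    grind
  classical
  rw [← hC, ← Finset.coe_insert, ← Finset.coe_insert, ← Finset.coe_insert, ← Finset.coe_insert,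
    ← Finset.coe_insert, ← Finset.coe_insert, chordLambda_coe, chordLambda_coe]
  simp only [mem_Icc] at *
  refine eightLambda_triangle_move crosses_symm not_crosses_self
    (hnot _ _ (Or.inl k₁₂)) ?_ ?_ (hnot _ _ (Or.inl l₁₂)) ?_ ?_ ?_ ?_ ?_ ?_ ?_ ?_ ?_ ?_ ?_ ?_
  · rw [Finset.mem_insert, not_or]
    exact ⟨fun h => o₁.ne (Prod.ext_iff.1 h).1, hnot _ _ (Or.inl k₁₃)⟩
  · rw [Finset.mem_insert, Finset.mem_insert, not_or, not_or]
    refine ⟨fun h => ?_, fun h => ?_, hnot _ _ (Or.inr k₂₃)⟩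
    · exact o₃.ne (Prod.ext_iff.1 h).2
    · have := (Prod.ext_iff.1 h).1
      simp only at this
      linarith
  · rw [Finset.mem_insert, not_or]
    exact ⟨fun h => u₁.ne' (Prod.ext_iff.1 h).1, hnot _ _ (Or.inl l₁₃)⟩
  · rw [Finset.mem_insert, Finset.mem_insert, not_or, not_or]
    refine ⟨fun h => ?_, fun h => ?_, hnot _ _ (Or.inr l₂₃)⟩
    · exact u₃.ne' (Prod.ext_iff.1 h).2
    · have := (Prod.ext_iff.1 h).1
      simp only at this
      linarith
  · simp only [Crosses]; rintro (h | h) <;> linarith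
  · simp only [Crosses]; rintro (h | h) <;> linarith
  · simp only [Crosses]; rintro (h | h) <;> linarith
  · exact Or.inl ⟨u₁, by simp only; linarith, by simp only; linarith⟩
  · exact Or.inl ⟨by simp only; linarith, u₂, by simp only; linarith⟩
  · exact Or.inl ⟨by simp only; linarith, by simp only; linarith, u₃⟩
  · intro o ho
    obtain ⟨h0, h1, h2⟩ := hmem o ho
    rw [crosses_first_second_iff l₁₂ l₂₁ hcd hde hef h0 h1 h2,
      crosses_first_second_iff k₁₂ k₂₁ hcd hde hef h0 h1 h2]
  · intro o ho
    obtain ⟨h0, h1, h2⟩ := hmem o ho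
    rw [crosses_first_third_iff l₁₃ l₃₁ hbc hcd hde hef h0 h1 h2,
      crosses_first_third_iff k₁₃ k₃₁ hbc hcd hde hef h0 h1 h2]
  · intro o ho
    obtain ⟨h0, h1, h2⟩ := hmem o ho
    rw [crosses_second_third_iff l₂₃ l₃₂ hcd hde hef h0 h1 h2,
      crosses_second_third_iff k₂₃ k₃₂ hcd hde hef h0 h1 h2]
  · intro o ho
    obtain ⟨h0, h1, h2⟩ := hmem o ho
    simp only [ind]
    rw [crosses_first_second_iff k₁₂ k₂₁ hcd hde hef h0 h1 h2,
      crosses_first_third_iff k₁₃ k₃₁ hbc hcd hde hef h0 h1 h2,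
      crosses_second_third_iff k₂₃ k₃₂ hcd hde hef h0 h1 h2]
    simp only [hU, mem_union, mem_Ioo] at h1 h2
    grind

end KnotProjection

theorem mainTheorem1 :
    (∀ P : KnotProjection, ∃ n : ℤ, P.lambdaInv = (n : ℚ)) ∧
    (∀ P Q : KnotProjection, KnotProjection.Equivalent P Q → P.lambdaInv = Q.lambdaInv) ∧
    (∀ P Q : KnotProjection, KnotProjection.RI P Q → P.lambdaInv = Q.lambdaInv) ∧
    (∀ P Q : KnotProjection, KnotProjection.StrongRIII P Q → P.lambdaInv = Q.lambdaInv) :=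
  ⟨fun P => P.exists_lambdaInv_eq_intCast, fun _ _ h => h.lambdaInv_eq,
    fun _ _ h => h.lambdaInv_eq, fun _ _ h => h.lambdaInv_eq⟩
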